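/- Let $B$ be a unital $C^*$-algebra. A set $I\subseteq B$ of self-adjoint elements is an \emph{isocone} of $B$ if it contains all real multiples of the unit, is closed under addition, satisfies $f(a)\in I$ for all $a\in I$ and all continuous non-decreasing $f:\mathbb R\to\mathbb R$ (functional calculus), is norm-closed, and $\overline{I-I}$ is the set of all self-adjoint elements of $B$. If $(P,\preceq)$ is a finite poset and $I_x$ is an isocone of $A_x$ for each $x\in P$, the \emph{lexicographic sum} is $$\boxplus_{x\in P} I_x=\Big\{(a_x)\in\bigoplus_{x\in P} I_x \;:\; x\prec y\Rightarrow \max\sigma(a_x)\le\min\sigma(a_y)\Big\}.$$ Let $S\subset M_2(\mathbb C)$ be the 2-sphere of rank-one orthogonal projections (with center $\tfrac12 1$, antipodal map $p\mapsto 1-p$). For $K\subseteq S$ put $I_K=\mathbb R_+K+\mathbb R 1$. Call $K$ geodesically convex if, for any two non-antipodal points of $K$, the smallest arc of great circle joining them lies in $K$. Let $A=\bigoplus_{x\in P}M_{n_x}(\mathbb C)$ with $P=\{1,\dots,k\}$, $k\ge1$, $n_x\ge1$, and let $\pi_x:A\to M_{n_x}(\mathbb C)$ be the projections. (1) For every isocone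 $I$ of $A$ there is a partial order on $P$ such that $I=\boxplus_{x\in P}I_x$, where $I_x=\pi_x(I)$. Moreover, each $I_x$ is an isocone of $M_{n_x}(\mathbb C)$; if $n_x\ne2$, then $I_x$ is the set of all Hermitian $n_x\times n_x$ matrices; if $n_x=2$, then $I_x=I_K$ for some compact geodesically convex $K\subseteq S$ with non-empty interior relative to $S$ (possibly $K=S$). (2) Conversely, for every partial order on $P$ and every choice of sets $I_x\subseteq M_{n_x}(\mathbb C)$, where $I_x$ is the set of all Hermitian matrices if $n_x\ne2$ and $I_x=I_K$ with $K$ as in (1) if $n_x=2$, the set $\boxplus_{x\in P}I_x$ is an isocone of $A$. -/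

import Mathlib

-- `Matrix m m ℂ` carries the C⋆-norm (the L2 operator norm); finite products carry the sup norm.
open scoped Matrix.Norms.L2Operator

/-- Isocones of a unital C⋆-algebra `A`: norm-closed sets of self-adjoint elements, containing the
real constants, stable under sums and under the functional calculus of all continuous
non-decreasing functions `ℝ → ℝ`, whose differences are dense in the self-adjoint part of `A`. -/
structure IsIsocone {A : Type*} [CStarAlgebra A] (I : Set A) : Prop where
  selfAdjoint : ∀ a ∈ I, IsSelfAdjoint a
  const_mem : ∀ r : ℝ, r • (1 : A) ∈ I
  add_mem : ∀ a ∈ I, ∀ b ∈ I, a + b ∈ I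
  isotone_mem : ∀ f : ℝ → ℝ, Continuous f → Monotone f → ∀ a ∈ I, cfc f a ∈ I
  closed : IsClosed I
  dense : closure {c : A | ∃ a ∈ I, ∃ b ∈ I, c = a - b} = {a : A | IsSelfAdjoint a}

/-- The lexicographic sum of the sets `J x ⊆ A x` over the poset `(P, ord)`: all `a` in the direct
sum of the `J x` with `max σ(a x) ≤ min σ(a y)` whenever `x ≺ y`. (Spectra are non-empty and compact
when `A x ≠ 0`; the inequality is spelled out elementwise.) -/
def lexSum {P : Type*} {A : P → Type*} [∀ x, CStarAlgebra (A x)]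
    (ord : PartialOrder P) (J : ∀ x, Set (A x)) : Set (∀ x, A x) :=
  {a | (∀ x, a x ∈ J x) ∧
    ∀ x y, ord.lt x y → ∀ s ∈ spectrum ℝ (a x), ∀ t ∈ spectrum ℝ (a y), s ≤ t}

/-- The 2-sphere of rank-one orthogonal projections in `M₂(ℂ)`. -/
def projSphere : Set (Matrix (Fin 2) (Fin 2) ℂ) :=
  {p | IsSelfAdjoint p ∧ p * p = p ∧ p.trace = 1}

/-- Geodesic convexity of `K ⊆ projSphere`. The center of the sphere is `1/2`, the antipode of `x` is
`1 - x`, and the smallest arc of great circle joining two non-antipodal points `x`, `y` consists of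
the points of the sphere lying, as seen from the center, in the cone spanned by `x` and `y`. -/
def IsGeodesicallyConvex (K : Set (Matrix (Fin 2) (Fin 2) ℂ)) : Prop :=
  ∀ x ∈ K, ∀ y ∈ K, y ≠ 1 - x → ∀ z ∈ projSphere,
    (∃ α β : ℝ, 0 ≤ α ∧ 0 ≤ β ∧
      z - (1 / 2 : ℝ) • 1 = α • (x - (1 / 2 : ℝ) • 1) + β • (y - (1 / 2 : ℝ) • 1)) → z ∈ K

/-- The set `I_K = ℝ₊ K + ℝ 1`. -/
def coneOver (K : Set (Matrix (Fin 2) (Fin 2) ℂ)) : Set (Matrix (Fin 2) (Fin 2) ℂ) :=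
  {a | ∃ t : ℝ, 0 ≤ t ∧ ∃ p ∈ K, ∃ s : ℝ, a = t • p + s • 1}

/-- The list of the isocones of full matrix algebras: all Hermitian matrices if `N ≠ 2`, and if
`N = 2` the sets `I_K` where `K` is a compact geodesically convex subset of the sphere of rank-one
projections with non-empty relative interior (`K` may be the whole sphere). -/
inductive IsListedIsocone : (N : ℕ) → Set (Matrix (Fin N) (Fin N) ℂ) → Prop
  | full (N : ℕ) (hN : N ≠ 2) : IsListedIsocone N {a | a.IsHermitian}
  | two (K : Set (Matrix (Fin 2) (Fin 2) ℂ)) (hKS : K ⊆ projSphere) (hKc : IsCompact K)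
      (hKg : IsGeodesicallyConvex K)
      (hKi : (interior {p : projSphere | (p : Matrix (Fin 2) (Fin 2) ℂ) ∈ K}).Nonempty) :
      IsListedIsocone 2 (coneOver K)

open Matrix

/-! ### Isocones in general: functional calculus, negation, interior points. -/

section CStar

variable {A : Type*} [CStarAlgebra A]

/-- The continuous functional calculus for the generic instance of a C⋆-algebra. -/
noncomputable abbrev cstarCfc (f : ℝ → ℝ) (a : A) : A := cfc f a

theorem map_cfc_of_cstar {B : Type*} [CStarAlgebra B] (φ : A →⋆ₐ[ℂ] B) (hφ : Continuous φ)
    {f : ℝ → ℝ} {a : A} (ha : IsSelfAdjoint a) (hf : Continuous f) :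
    φ (cfc f a) = cfc f (φ a) :=
  StarAlgHomClass.map_cfc (S := ℂ) φ f a hf.continuousOn hφ ha (ha.map φ)

theorem cfc_pi_apply {P : Type*} [Fintype P] {A : P → Type*} [∀ x, CStarAlgebra (A x)]
    {f : ℝ → ℝ} {a : ∀ x, A x} (ha : IsSelfAdjoint a) (hf : Continuous f) (x : P) :
    cstarCfc f a x = cfc f (a x) :=
  map_cfc_of_cstar (Pi.evalStarAlgHom ℂ A x) (continuous_apply x) ha hf

namespace IsIsocone

variable {I : Set A}

theorem smul_mem (hI : IsIsocone I) {r : ℝ} (hr : 0 ≤ r) {a : A} (ha : a ∈ I) : r • a ∈ I := by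
  have h := hI.isotone_mem (fun t => r * t) (by fun_prop)
    (fun s t hst => mul_le_mul_of_nonneg_left hst hr) a ha
  rwa [cfc_const_mul_id r a (hI.selfAdjoint a ha)] at h

theorem add_const_mem (hI : IsIsocone I) {a : A} (ha : a ∈ I) (r : ℝ) : a + r • (1 : A) ∈ I :=
  hI.add_mem a ha _ (hI.const_mem r)

/-- The conjugate t ↦ -f(-t) of a continuous non-decreasing function is again one. This symmetry
turns statements about joins into statements about meets. -/
theorem neg (hI : IsIsocone I) : IsIsocone {a | -a ∈ I} where
  selfAdjoint a ha := by simpa using (hI.selfAdjoint _ ha).neg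
  const_mem r := by
    have := hI.const_mem (-r)
    rwa [neg_smul] at this
  add_mem a ha b hb := by
    have := hI.add_mem _ ha _ hb
    rwa [← neg_add] at this
  isotone_mem f hf hm a ha := by
    have hsa : IsSelfAdjoint a := by simpa using (hI.selfAdjoint _ ha).neg
    have h := hI.isotone_mem (fun t => - f (-t)) (by fun_prop)
      (fun s t hst => neg_le_neg (hm (neg_le_neg hst))) _ ha
    have h2 : cfc (fun t => - f (-t)) (-a) = - cfc f a := by
      rw [cfc_neg (fun t => f (-t)) (-a), cfc_comp_neg f (-a) (by fun_prop) hsa.neg, neg_neg]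
    rwa [h2] at h
  closed := hI.closed.preimage continuous_neg
  dense := by
    rw [← hI.dense]
    congr 1
    ext c
    constructor
    · rintro ⟨a, ha, b, hb, rfl⟩
      exact ⟨-b, hb, -a, ha, by abel⟩
    · rintro ⟨a, ha, b, hb, rfl⟩
      exact ⟨-b, by simpa using hb, -a, by simpa using ha, by abel⟩

/-- In finite dimension an isocone has interior points relative to the self-adjoint part. -/
theorem exists_interior [FiniteDimensional ℝ A] (hI : IsIsocone I) :
    ∃ a₀ ∈ I, ∃ δ > 0, ∀ h : A, IsSelfAdjoint h → ‖h‖ ≤ δ → a₀ + h ∈ I := by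
  let incl : _root_.selfAdjoint A →ₗ[ℝ] A :=
    { toFun := fun a => a, map_add' := fun _ _ => rfl, map_smul' := fun _ _ => rfl }
  have : FiniteDimensional ℝ (_root_.selfAdjoint A) :=
    Module.Finite.of_injective incl Subtype.val_injective
  let J : Set (_root_.selfAdjoint A) := {a | (a : A) ∈ I}
  have h0 : (0 : _root_.selfAdjoint A) ∈ J := by
    simpa [J] using hI.const_mem 0
  have hconv : Convex ℝ J := by
    intro a ha b hb s t hs ht _
    have := hI.add_mem _ (hI.smul_mem hs ha) _ (hI.smul_mem ht hb)
    simpa [J] using this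
  -- A subspace is closed in finite dimension, so density of the differences already makes the span
  -- everything.
  have hspan : Submodule.span ℝ J = ⊤ := by
    have hcl : IsClosed (Submodule.span ℝ J : Set (_root_.selfAdjoint A)) :=
      Submodule.closed_of_finiteDimensional _
    rw [eq_top_iff]
    rintro ⟨a, ha⟩ -
    have ha' : a ∈ closure {c : A | ∃ a ∈ I, ∃ b ∈ I, c = a - b} := by
      rw [hI.dense]; exact ha
    have h2 : (⟨a, ha⟩ : _root_.selfAdjoint A) ∈ closure (Submodule.span ℝ J : Set (_root_.selfAdjoint A)) := by
      rw [closure_subtype]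
      refine closure_mono ?_ ha'
      rintro _ ⟨b, hb, c, hc, rfl⟩
      exact ⟨⟨b, hI.selfAdjoint b hb⟩ - ⟨c, hI.selfAdjoint c hc⟩,
        Submodule.sub_mem _ (Submodule.subset_span hb) (Submodule.subset_span hc), rfl⟩
    rwa [hcl.closure_eq] at h2
  have haff : affineSpan ℝ J = ⊤ := by
    rw [AffineSubspace.affineSpan_eq_top_iff_vectorSpan_eq_top_of_nonempty _ _ _ ⟨0, h0⟩,
      eq_top_iff, ← hspan, Submodule.span_le]
    intro a ha
    simpa using vsub_mem_vectorSpan ℝ ha h0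
  obtain ⟨a₀, ha₀⟩ := (hconv.interior_nonempty_iff_affineSpan_eq_top).2 haff
  obtain ⟨δ, hδ, hball⟩ := Metric.isOpen_iff.1 isOpen_interior a₀ ha₀
  refine ⟨a₀, (interior_subset ha₀ : a₀ ∈ J), δ / 2, by positivity, fun h hh hn => ?_⟩
  have : a₀ + ⟨h, hh⟩ ∈ Metric.ball a₀ δ := by
    rw [mem_ball_iff_norm, add_sub_cancel_left]
    exact lt_of_le_of_lt hn (by linarith)
  exact (interior_subset (hball this) : _ ∈ J)

theorem cfc_pi_mem {P : Type*} [Fintype P] {A : P → Type*} [∀ x, CStarAlgebra (A x)]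
    {I : Set (∀ x, A x)} (hI : IsIsocone I) {f : ℝ → ℝ} (hf : Continuous f) (hm : Monotone f)
    {a : ∀ x, A x} (ha : a ∈ I) : (fun x => cfc f (a x)) ∈ I := by
  convert hI.isotone_mem f hf hm a ha with x
  exact (cfc_pi_apply (hI.selfAdjoint a ha) hf x).symm

end IsIsocone

end CStar

/-! ### Functional calculus on eigenvectors and spectral projections. -/

section Spectral

variable {m : Type*} [Fintype m] [DecidableEq m]

/-- The spectrum is finite, so every f is continuous on it and f(a) = f(l) + g(a)(a - l), with g the
divided difference of f at l; the last term kills v. The value of g at l is irrelevant, being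
multiplied by 0. -/
theorem cfc_mulVec {a : Matrix m m ℂ} (ha : IsSelfAdjoint a) (f : ℝ → ℝ) {v : m → ℂ} {l : ℝ}
    (hv : a *ᵥ v = l • v) : cfc f a *ᵥ v = f l • v := by
  have hc : ∀ g : ℝ → ℝ, ContinuousOn g (spectrum ℝ a) := fun g =>
    (finite_real_spectrum (A := a)).continuousOn g
  have h1 : cfc f a = f l • 1 + cfc (fun t => (f t - f l) / (t - l)) a * (a - l • 1) := by
    have h2 : a - l • 1 = cfc (fun t => t - l) a := by
      rw [cfc_sub (fun t => t) (fun _ => l) a (hc _) (hc _), cfc_id' ℝ a, cfc_const _ a ha,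
        Algebra.algebraMap_eq_smul_one]
    have h3 : f l • (1 : Matrix m m ℂ) = cfc (fun _ => f l) a := by
      rw [cfc_const _ a ha, Algebra.algebraMap_eq_smul_one]
    rw [h2, h3, ← cfc_mul _ _ a (hc _) (hc _), ← cfc_add a _ _ (hc _) (hc _)]
    refine cfc_congr fun t _ => ?_
    by_cases h : t = l
    · simp [h]
    · have : t - l ≠ 0 := sub_ne_zero.2 h
      field_simp
      ring
  rw [h1, add_mulVec, ← mulVec_mulVec, sub_mulVec, hv, smul_mulVec, smul_mulVec]
  simp

theorem ext_of_eigenvectors {a : Matrix m m ℂ} (ha : IsSelfAdjoint a) {b c : Matrix m m ℂ}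
    (h : ∀ (l : ℝ) (v : m → ℂ), a *ᵥ v = l • v → b *ᵥ v = c *ᵥ v) : b = c := by
  have ha' : a.IsHermitian := ha
  have h1 : toEuclideanLin b = toEuclideanLin c := by
    refine ha'.eigenvectorBasis.toBasis.ext fun i => ?_
    have := h _ _ (ha'.mulVec_eigenvectorBasis i)
    simp [toEuclideanLin, toLpLin_apply, this]
  exact toEuclideanLin.injective h1

theorem mem_spectrum_iff_eigenvector {a : Matrix m m ℂ} (ha : IsSelfAdjoint a) {l : ℝ} :
    l ∈ spectrum ℝ a ↔ ∃ v : m → ℂ, v ≠ 0 ∧ a *ᵥ v = l • v := by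
  have ha' : a.IsHermitian := ha
  constructor
  · rw [ha'.spectrum_real_eq_range_eigenvalues]
    rintro ⟨i, rfl⟩
    refine ⟨_, fun h => ha'.eigenvectorBasis.orthonormal.ne_zero i ?_,
      ha'.mulVec_eigenvectorBasis i⟩
    ext j
    exact congrFun h j
  · rintro ⟨v, hv, h⟩
    rw [spectrum.mem_iff]
    intro hu
    have h0 : (algebraMap ℝ (Matrix m m ℂ) l - a) *ᵥ v = 0 := by
      rw [sub_mulVec, h, Algebra.algebraMap_eq_smul_one, smul_mulVec, one_mulVec, sub_self]
    obtain ⟨u, hu⟩ := hu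
    apply hv
    rw [← one_mulVec v, ← u.inv_mul, ← mulVec_mulVec, hu, h0, mulVec_zero]

/-- The spectral projection of `a` for the interval `(c, ∞)`. -/
noncomputable def upperProj (c : ℝ) (a : Matrix m m ℂ) : Matrix m m ℂ :=
  cfc (fun t : ℝ => if c < t then (1 : ℝ) else 0) a

theorem upperProj_mulVec_of_lt {a : Matrix m m ℂ} (ha : IsSelfAdjoint a) {c l : ℝ} {v : m → ℂ}
    (hv : a *ᵥ v = l • v) (h : c < l) : upperProj c a *ᵥ v = v := by
  rw [upperProj, cfc_mulVec ha _ hv, if_pos h, one_smul]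

theorem upperProj_mulVec_of_le {a : Matrix m m ℂ} (ha : IsSelfAdjoint a) {c l : ℝ} {v : m → ℂ}
    (hv : a *ᵥ v = l • v) (h : l ≤ c) : upperProj c a *ᵥ v = 0 := by
  rw [upperProj, cfc_mulVec ha _ hv, if_neg h.not_gt, zero_smul]

theorem isStarProjection_upperProj {a : Matrix m m ℂ} (ha : IsSelfAdjoint a) (c : ℝ) :
    IsStarProjection (upperProj c a) := by
  refine ⟨ext_of_eigenvectors ha fun l v hv => ?_, cfc_predicate _ a⟩
  rw [← mulVec_mulVec]
  rcases lt_or_ge c l with h | h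
  · simp only [upperProj_mulVec_of_lt ha hv h]
  · simp only [upperProj_mulVec_of_le ha hv h, mulVec_zero]

/-- The eigenvalues are 0 and 1, separated by 1/2. This lifts a projection found in one block of an
element of I to a projection of I. -/
theorem upperProj_of_isStarProjection {p : Matrix m m ℂ} (hp : IsStarProjection p) :
    upperProj (1 / 2) p = p := by
  refine ext_of_eigenvectors hp.isSelfAdjoint fun l v hv => ?_
  have h1 : p *ᵥ (p *ᵥ v) = p *ᵥ v := by
    rw [mulVec_mulVec, hp.isIdempotentElem]
  rw [hv, mulVec_smul, hv, smul_smul, ← sub_eq_zero, ← sub_smul, smul_eq_zero] at h1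
  rcases h1 with h1 | h1
  · have : l = 0 ∨ l = 1 := by
      have : l * (l - 1) = 0 := by linarith
      rcases mul_eq_zero.1 this with h | h
      · exact .inl h
      · exact .inr (by linarith)
    rcases this with rfl | rfl
    · rw [upperProj_mulVec_of_le hp.isSelfAdjoint hv (by norm_num), hv, zero_smul]
    · rw [upperProj_mulVec_of_lt hp.isSelfAdjoint hv (by norm_num), hv, one_smul]
  · simp [h1]

/-- A finite set leaves a gap (c, d) above c, and a linear ramp across the gap is continuous. -/
theorem exists_monotone_step (S : Set ℝ) (hS : S.Finite) (c : ℝ) :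
    ∃ f : ℝ → ℝ, Continuous f ∧ Monotone f ∧ ∀ t ∈ S, f t = if c < t then 1 else 0 := by
  obtain ⟨d, hcd, hd⟩ : ∃ d, c < d ∧ ∀ t ∈ S, c < t → d ≤ t := by
    have hfin : {t ∈ S | c < t}.Finite := hS.subset (Set.sep_subset _ _)
    rcases Set.eq_empty_or_nonempty {t ∈ S | c < t} with h | h
    · refine ⟨c + 1, by linarith, fun t ht hct => ?_⟩
      have : t ∈ {t ∈ S | c < t} := ⟨ht, hct⟩
      rw [h] at this
      exact this.elim
    · obtain ⟨d, hd, hmin⟩ := hfin.exists_minimalFor id _ h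
      refine ⟨d, hd.2, fun t ht hct => ?_⟩
      rcases le_total d t with h | h
      · exact h
      · exact hmin ⟨ht, hct⟩ h
  have hpos : 0 < d - c := by linarith
  refine ⟨fun t => max 0 (min 1 ((t - c) / (d - c))), by fun_prop, fun s t hst => ?_,
    fun t ht => ?_⟩
  · have : (s - c) / (d - c) ≤ (t - c) / (d - c) := by gcongr
    exact max_le_max le_rfl (min_le_min le_rfl this)
  · split_ifs with h
    · have : 1 ≤ (t - c) / (d - c) := by
        rw [le_div_iff₀ hpos]
        linarith [hd t ht h]
      simp [this]
    · have : (t - c) / (d - c) ≤ 0 := div_nonpos_of_nonpos_of_nonneg (by linarith) hpos.le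
      simp [this]

end Spectral

/-- Direct sums of full matrix algebras. -/
abbrev BlockMatrix {P : Type*} (n : P → ℕ) : Type _ := ∀ x : P, Matrix (Fin (n x)) (Fin (n x)) ℂ

theorem IsIsocone.upperProj_mem {P : Type*} [Fintype P] {n : P → ℕ} {I : Set (BlockMatrix n)}
    (hI : IsIsocone I) {a : BlockMatrix n} (ha : a ∈ I) (c : ℝ) :
    (fun x => upperProj c (a x)) ∈ I := by
  obtain ⟨f, hf, hm, hfc⟩ := exists_monotone_step (⋃ x, spectrum ℝ (a x))
    (Set.finite_iUnion fun x => finite_real_spectrum) c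
  convert hI.cfc_pi_mem hf hm ha with x
  exact cfc_congr fun t ht => (hfc t (Set.mem_iUnion.2 ⟨x, ht⟩)).symm

open scoped ComplexOrder in
theorem star_dotProduct_self_eq_zero {m : Type*} [Fintype m] {v : m → ℂ} :
    star v ⬝ᵥ v = 0 ↔ v = 0 := dotProduct_star_self_eq_zero

open scoped ComplexOrder in
theorem exists_star_dotProduct_self {m : Type*} [Fintype m] (v : m → ℂ) :
    ∃ r : ℝ, 0 ≤ r ∧ star v ⬝ᵥ v = r := by
  have h := dotProduct_star_self_nonneg v
  rw [Complex.le_def] at h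
  exact ⟨(star v ⬝ᵥ v).re, by simpa using h.1, Complex.ext (by simp) (by simpa using h.2.symm)⟩

/-! ### Joins and meets of projections. -/

section StarProjection

variable {m : Type*} [Fintype m] {p q : Matrix m m ℂ}

theorem star_dotProduct_mulVec_of_isSelfAdjoint (hp : IsSelfAdjoint p) (u v : m → ℂ) :
    star u ⬝ᵥ (p *ᵥ v) = star (p *ᵥ u) ⬝ᵥ v := by
  have h : pᴴ = p := hp
  rw [star_mulVec, h, dotProduct_mulVec]

theorem IsStarProjection.mulVec_mulVec (hp : IsStarProjection p) (v : m → ℂ) :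
    p *ᵥ (p *ᵥ v) = p *ᵥ v := by
  rw [Matrix.mulVec_mulVec, hp.isIdempotentElem]

theorem IsStarProjection.star_dotProduct_mulVec (hp : IsStarProjection p) (v : m → ℂ) :
    star v ⬝ᵥ (p *ᵥ v) = star (p *ᵥ v) ⬝ᵥ (p *ᵥ v) := by
  rw [← star_dotProduct_mulVec_of_isSelfAdjoint hp.isSelfAdjoint, hp.mulVec_mulVec]

/-- Pairing with v gives ‖pv‖² + ‖qv‖² = l‖v‖² ≤ 0. -/
theorem mulVec_eq_zero_of_add_mulVec (hp : IsStarProjection p) (hq : IsStarProjection q)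
    {v : m → ℂ} {l : ℝ} (hl : l ≤ 0) (hv : (p + q) *ᵥ v = l • v) :
    p *ᵥ v = 0 ∧ q *ᵥ v = 0 := by
  have h := congrArg (star v ⬝ᵥ ·) hv
  simp only [add_mulVec, dotProduct_add, hp.star_dotProduct_mulVec, hq.star_dotProduct_mulVec,
    dotProduct_smul] at h
  obtain ⟨r, hr, er⟩ := exists_star_dotProduct_self v
  obtain ⟨s, hs, es⟩ := exists_star_dotProduct_self (p *ᵥ v)
  obtain ⟨t, ht, et⟩ := exists_star_dotProduct_self (q *ᵥ v)
  rw [er, es, et, Complex.real_smul] at h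
  have h' : s + t = l * r := by exact_mod_cast h
  have h2 : l * r ≤ 0 := mul_nonpos_of_nonpos_of_nonneg hl hr
  have hs0 : s = 0 := by linarith
  have ht0 : t = 0 := by linarith
  rw [hs0] at es
  rw [ht0] at et
  exact ⟨star_dotProduct_self_eq_zero.1 (by simpa using es),
    star_dotProduct_self_eq_zero.1 (by simpa using et)⟩

variable [DecidableEq m]

/-- A star projection is determined by its range and kernel. -/
theorem IsStarProjection.eq_of_mulVec (hp : IsStarProjection p)
    (h1 : ∀ u, p *ᵥ u = u → q *ᵥ u = u) (h0 : ∀ u, p *ᵥ u = 0 → q *ᵥ u = 0) : q = p := by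
  refine Matrix.ext_of_mulVec_single fun i => ?_
  set u : m → ℂ := Pi.single i 1
  have e1 := h1 _ (hp.mulVec_mulVec u)
  have e0 := h0 (u - p *ᵥ u) (by rw [mulVec_sub, hp.mulVec_mulVec, sub_self])
  rw [mulVec_sub, e1, sub_eq_zero] at e0
  exact e0

/-- With E the spectral projection, pE = p because p kills the eigenvectors of p + q that E kills;
the adjoint identity Ep = p is the claim. -/
theorem upperProj_add_mulVec_left (hp : IsStarProjection p) (hq : IsStarProjection q) {u : m → ℂ}
    (hu : p *ᵥ u = u) : upperProj 0 (p + q) *ᵥ u = u := by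
  have hpq := hp.isSelfAdjoint.add hq.isSelfAdjoint
  have h : p * upperProj 0 (p + q) = p := by
    refine ext_of_eigenvectors hpq fun l v hv => ?_
    rw [← Matrix.mulVec_mulVec]
    rcases lt_or_ge 0 l with hl | hl
    · rw [upperProj_mulVec_of_lt hpq hv hl]
    · rw [upperProj_mulVec_of_le hpq hv hl, (mulVec_eq_zero_of_add_mulVec hp hq hl hv).1,
        mulVec_zero]
  have h2 : upperProj 0 (p + q) * p = p := by
    have := congrArg star h
    rwa [star_mul, hp.isSelfAdjoint.star_eq,
      (isStarProjection_upperProj hpq 0).isSelfAdjoint.star_eq] at this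
  conv_lhs => rw [← hu]
  rw [Matrix.mulVec_mulVec, h2, hu]

theorem upperProj_add_mulVec_right (hp : IsStarProjection p) (hq : IsStarProjection q)
    {u : m → ℂ} (hu : q *ᵥ u = u) : upperProj 0 (p + q) *ᵥ u = u := by
  rw [add_comm]
  exact upperProj_add_mulVec_left hq hp hu

theorem upperProj_add_mulVec_eq_zero (hp : IsStarProjection p) (hq : IsStarProjection q)
    {u : m → ℂ} (hpu : p *ᵥ u = 0) (hqu : q *ᵥ u = 0) : upperProj 0 (p + q) *ᵥ u = 0 :=
  upperProj_mulVec_of_le (hp.isSelfAdjoint.add hq.isSelfAdjoint) (l := 0)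
    (by rw [add_mulVec, hpu, hqu, add_zero, zero_smul]) le_rfl

end StarProjection

/-- The projections contained in a set of block matrices. -/
def projections {P : Type*} {n : P → ℕ} (I : Set (BlockMatrix n)) : Set (BlockMatrix n) :=
  {p | p ∈ I ∧ ∀ x, IsStarProjection (p x)}

namespace IsIsocone

variable {P : Type*} [Fintype P] {n : P → ℕ} {I : Set (BlockMatrix n)}

theorem isSelfAdjoint_apply (hI : IsIsocone I) {a : BlockMatrix n} (ha : a ∈ I) (x : P) :
    IsSelfAdjoint (a x) := congrFun (hI.selfAdjoint a ha) x

theorem zero_mem_projections (hI : IsIsocone I) : (0 : BlockMatrix n) ∈ projections I :=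
  ⟨by simpa using hI.const_mem 0, fun _ => .zero _⟩

theorem one_mem_projections (hI : IsIsocone I) : (1 : BlockMatrix n) ∈ projections I :=
  ⟨by simpa using hI.const_mem 1, fun _ => .one _⟩

theorem upperProj_mem_projections (hI : IsIsocone I) {a : BlockMatrix n} (ha : a ∈ I) (c : ℝ) :
    (fun x => upperProj c (a x)) ∈ projections I :=
  ⟨hI.upperProj_mem ha c, fun x => isStarProjection_upperProj (hI.isSelfAdjoint_apply ha x) c⟩

theorem exists_join (hI : IsIsocone I) {p q : BlockMatrix n} (hp : p ∈ projections I)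
    (hq : q ∈ projections I) : ∃ r ∈ projections I, ∀ x u,
      (p x *ᵥ u = u → r x *ᵥ u = u) ∧ (q x *ᵥ u = u → r x *ᵥ u = u) ∧
      (p x *ᵥ u = 0 → q x *ᵥ u = 0 → r x *ᵥ u = 0) :=
  ⟨_, hI.upperProj_mem_projections (hI.add_mem _ hp.1 _ hq.1) 0, fun x _ =>
    ⟨upperProj_add_mulVec_left (hp.2 x) (hq.2 x), upperProj_add_mulVec_right (hp.2 x) (hq.2 x),
      upperProj_add_mulVec_eq_zero (hp.2 x) (hq.2 x)⟩⟩

theorem one_sub_mem_projections (hI : IsIsocone I) {p : BlockMatrix n}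
    (hp : p ∈ projections {a | -a ∈ I}) : 1 - p ∈ projections I :=
  ⟨by simpa [sub_eq_add_neg] using hI.add_mem _ hI.one_mem_projections.1 _ hp.1,
    fun x => (hp.2 x).one_sub⟩

theorem one_sub_mem_projections_neg (hI : IsIsocone I) {p : BlockMatrix n}
    (hp : p ∈ projections I) : 1 - p ∈ projections {a | -a ∈ I} :=
  hI.neg.one_sub_mem_projections (by simpa [projections] using hp)

theorem exists_meet (hI : IsIsocone I) {p q : BlockMatrix n} (hp : p ∈ projections I)
    (hq : q ∈ projections I) : ∃ r ∈ projections I, ∀ x u,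
      (p x *ᵥ u = 0 → r x *ᵥ u = 0) ∧ (q x *ᵥ u = 0 → r x *ᵥ u = 0) ∧
      (p x *ᵥ u = u → q x *ᵥ u = u → r x *ᵥ u = u) := by
  obtain ⟨r, hr, h⟩ := hI.neg.exists_join (hI.one_sub_mem_projections_neg hp)
    (hI.one_sub_mem_projections_neg hq)
  refine ⟨1 - r, hI.one_sub_mem_projections hr, fun x u => ?_⟩
  have h := h x u
  simp only [Pi.sub_apply, Pi.one_apply, sub_mulVec, one_mulVec, sub_eq_self, sub_eq_zero] at h ⊢
  exact ⟨fun e => (h.1 e).symm, fun e => (h.2.1 e).symm, fun e1 e2 => h.2.2 e1.symm e2.symm⟩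

theorem exists_finset_join (hI : IsIsocone I) {ι : Type*} (s : Finset ι) (p : ι → BlockMatrix n)
    (hp : ∀ i ∈ s, p i ∈ projections I) : ∃ r ∈ projections I, ∀ x u,
      (∀ i ∈ s, p i x *ᵥ u = u → r x *ᵥ u = u) ∧
      ((∀ i ∈ s, p i x *ᵥ u = 0) → r x *ᵥ u = 0) := by
  classical
  induction s using Finset.induction_on with
  | empty => exact ⟨0, hI.zero_mem_projections, fun x u => by simp⟩
  | insert j s _ ih =>
    obtain ⟨r, hr, h⟩ := ih fun i hi => hp i (Finset.mem_insert_of_mem hi)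
    obtain ⟨r', hr', h'⟩ := hI.exists_join (hp j (Finset.mem_insert_self _ _)) hr
    refine ⟨r', hr', fun x u => ⟨fun i hi e => ?_, fun e => ?_⟩⟩
    · rcases Finset.mem_insert.1 hi with rfl | hi
      · exact (h' x u).1 e
      · exact (h' x u).2.1 ((h x u).1 i hi e)
    · exact (h' x u).2.2 (e j (Finset.mem_insert_self _ _))
        ((h x u).2 fun i hi => e i (Finset.mem_insert_of_mem hi))

theorem exists_finset_meet (hI : IsIsocone I) {ι : Type*} (s : Finset ι) (p : ι → BlockMatrix n)
    (hp : ∀ i ∈ s, p i ∈ projections I) : ∃ r ∈ projections I, ∀ x u,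
      (∀ i ∈ s, p i x *ᵥ u = 0 → r x *ᵥ u = 0) ∧
      ((∀ i ∈ s, p i x *ᵥ u = u) → r x *ᵥ u = u) := by
  obtain ⟨r, hr, h⟩ := hI.neg.exists_finset_join s (fun i => 1 - p i) fun i hi =>
    hI.one_sub_mem_projections_neg (hp i hi)
  refine ⟨1 - r, hI.one_sub_mem_projections hr, fun x u => ?_⟩
  have h := h x u
  simp only [Pi.sub_apply, Pi.one_apply, sub_mulVec, one_mulVec, sub_eq_self, sub_eq_zero] at h ⊢
  exact ⟨fun i hi e => (h.1 i hi e).symm, fun e => (h.2 fun i hi => (e i hi).symm)⟩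

/-- An isocone is determined by its projections. -/
theorem mem_of_upperProj_mem (hI : IsIsocone I) {b : BlockMatrix n} (hb : IsSelfAdjoint b)
    (h : ∀ c, (fun x => upperProj c (b x)) ∈ I) : b ∈ I := by
  -- Layers are added from the top: `e` agrees with `b` on eigenvalues in `F` and is cut off at the
  -- floor `c` on those at most `c`. A new minimum `d` lowers the floor from `d` to `c` by adding (d
  -- - c)(`upperProj c b` - 1).
  have key : ∀ F : Finset ℝ, ∀ c : ℝ, (∀ u ∈ F, c < u) → ∃ e ∈ I, ∀ x v (u : ℝ),
      b x *ᵥ v = u • v → (u ∈ F → e x *ᵥ v = u • v) ∧ (u ≤ c → e x *ᵥ v = c • v) := by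
    intro F
    induction F using Finset.induction_on_min with
    | empty => exact fun c _ => ⟨c • 1, hI.const_mem c, fun x v u _ => by simp [smul_mulVec]⟩
    | insert d F hd ih =>
      intro c hc
      have hcd : c < d := hc d (Finset.mem_insert_self _ _)
      obtain ⟨e, he, hev⟩ := ih d hd
      refine ⟨e + ((d - c) • (fun x => upperProj c (b x)) + (-(d - c)) • 1),
        hI.add_mem _ he _ (hI.add_const_mem (hI.smul_mem (sub_nonneg.2 hcd.le) (h c)) _),
        fun x v u hu => ?_⟩
      obtain ⟨h1, h2⟩ := hev x v u hu
      have hbx : IsSelfAdjoint (b x) := congrFun hb x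
      simp only [Pi.add_apply, Pi.smul_apply, Pi.one_apply, add_mulVec, smul_mulVec, one_mulVec]
      constructor
      · intro hm
        rw [upperProj_mulVec_of_lt hbx hu (hc u hm), ← add_smul, add_neg_cancel, zero_smul,
          add_zero]
        rcases Finset.mem_insert.1 hm with rfl | hm
        · exact h2 le_rfl
        · exact h1 hm
      · intro hm
        rw [upperProj_mulVec_of_le hbx hu hm, smul_zero, zero_add, h2 (hm.trans hcd.le),
          ← add_smul]
        congr 1
        ring
  have hfin : (⋃ x, spectrum ℝ (b x)).Finite := Set.finite_iUnion fun x => finite_real_spectrum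
  obtain ⟨c, hc⟩ := hfin.bddBelow
  obtain ⟨e, he, hev⟩ := key hfin.toFinset (c - 1) fun u hu => by
    linarith [hc (hfin.mem_toFinset.1 hu)]
  suffices b = e from this ▸ he
  funext x
  have hbx : IsSelfAdjoint (b x) := congrFun hb x
  refine ext_of_eigenvectors hbx fun l v hv => ?_
  by_cases hv0 : v = 0
  · simp [hv0]
  · rw [hv, (hev x v l hv).1]
    exact hfin.mem_toFinset.2 (Set.mem_iUnion.2 ⟨x, (mem_spectrum_iff_eigenvector hbx).2
      ⟨v, hv0, hv⟩⟩)

end IsIsocone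

/-! ### Bounds on Rayleigh quotients. -/

section Rayleigh

variable {m : Type*} [Fintype m] {a : Matrix m m ℂ}

theorem re_star_dotProduct_self_nonneg (v : m → ℂ) : 0 ≤ (star v ⬝ᵥ v).re := by
  obtain ⟨r, hr, e⟩ := exists_star_dotProduct_self v
  simpa [e] using hr

theorem re_star_dotProduct_self_pos {v : m → ℂ} (hv : v ≠ 0) : 0 < (star v ⬝ᵥ v).re := by
  refine lt_of_le_of_ne (re_star_dotProduct_self_nonneg v) fun h => hv ?_
  obtain ⟨r, _, e⟩ := exists_star_dotProduct_self v
  rw [e, Complex.ofReal_re] at h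
  exact star_dotProduct_self_eq_zero.1 (by rw [e, ← h, Complex.ofReal_zero])

variable [DecidableEq m]

open scoped ComplexOrder in
theorem re_star_dotProduct_mulVec_le (ha : IsSelfAdjoint a) {c : ℝ}
    (h : ∀ l ∈ spectrum ℝ a, l ≤ c) (u : m → ℂ) :
    (star u ⬝ᵥ (a *ᵥ u)).re ≤ c * (star u ⬝ᵥ u).re := by
  have hb : IsSelfAdjoint (c • (1 : Matrix m m ℂ) - a) :=
    ((IsSelfAdjoint.all c).smul (IsSelfAdjoint.one _)).sub ha
  have hb' : (c • (1 : Matrix m m ℂ) - a).IsHermitian := hb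
  have hpos : (c • (1 : Matrix m m ℂ) - a).PosSemidef := by
    rw [hb'.posSemidef_iff_eigenvalues_nonneg]
    intro i
    have hv := hb'.mulVec_eigenvectorBasis i
    set v := (hb'.eigenvectorBasis i).ofLp with hvdef
    have hv0 : v ≠ 0 := fun h0 => hb'.eigenvectorBasis.orthonormal.ne_zero i (by
      ext j; exact congrFun h0 j)
    rw [sub_mulVec, smul_mulVec, one_mulVec, sub_eq_iff_eq_add, ← sub_eq_iff_eq_add',
      ← sub_smul] at hv
    have := h _ ((mem_spectrum_iff_eigenvector ha).2 ⟨v, hv0, hv.symm⟩)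
    simpa using this
  have h1 := hpos.dotProduct_mulVec_nonneg u
  rw [Complex.le_def] at h1
  have h2 := h1.1
  simp only [sub_mulVec, smul_mulVec, one_mulVec, dotProduct_sub, dotProduct_smul,
    Complex.sub_re, Complex.zero_re, Complex.real_smul, Complex.re_ofReal_mul] at h2
  linarith

theorem le_re_star_dotProduct_mulVec (ha : IsSelfAdjoint a) {c : ℝ}
    (h : ∀ l ∈ spectrum ℝ a, c ≤ l) (u : m → ℂ) :
    c * (star u ⬝ᵥ u).re ≤ (star u ⬝ᵥ (a *ᵥ u)).re := by
  have := re_star_dotProduct_mulVec_le ha.neg (c := -c) (fun l hl => by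
    rw [← spectrum.neg_eq, Set.mem_neg] at hl
    linarith [h _ hl]) u
  simp only [neg_mulVec, dotProduct_neg, Complex.neg_re] at this
  linarith

end Rayleigh

/-! ### Rank-one projections and tilting of eigenvectors. -/

section LineProjection

theorem tendsto_add_smul {m : Type*} (v z : m → ℂ) :
    Filter.Tendsto (fun ε : ℝ => v + ε • z) (nhdsWithin 0 (Set.Ioi 0)) (nhds v) := by
  have : Continuous fun ε : ℝ => v + ε • z := by fun_prop
  simpa using this.continuousWithinAt.tendsto (x := (0 : ℝ)) (s := Set.Ioi 0)

theorem exists_pos_add_smul {m : Type*} {v : m → ℂ} {p : (m → ℂ) → Prop}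
    (h : ∀ᶠ w in nhds v, p w) (z : m → ℂ) : ∃ ε : ℝ, 0 < ε ∧ p (v + ε • z) := by
  obtain ⟨ε, h1, h2⟩ := (((tendsto_add_smul v z).eventually h).and self_mem_nhdsWithin).exists
  exact ⟨ε, h2, h1⟩

variable {m : Type*} [Fintype m] {v w : m → ℂ}

/-- The orthogonal projection onto the line spanned by `w`. -/
noncomputable def lineProj (w : m → ℂ) : Matrix m m ℂ :=
  (star w ⬝ᵥ w)⁻¹ • vecMulVec w (star w)

theorem lineProj_mulVec (w u : m → ℂ) :
    lineProj w *ᵥ u = ((star w ⬝ᵥ w)⁻¹ * (star w ⬝ᵥ u)) • w := by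
  rw [lineProj, smul_mulVec, vecMulVec_mulVec, op_smul_eq_smul, smul_smul]

theorem lineProj_mulVec_self (hw : w ≠ 0) : lineProj w *ᵥ w = w := by
  rw [lineProj_mulVec, inv_mul_cancel₀ (star_dotProduct_self_eq_zero.not.2 hw), one_smul]

theorem lineProj_mulVec_of_orthogonal {u : m → ℂ} (h : star w ⬝ᵥ u = 0) :
    lineProj w *ᵥ u = 0 := by
  rw [lineProj_mulVec, h, mul_zero, zero_smul]

theorem isStarProjection_lineProj (hw : w ≠ 0) : IsStarProjection (lineProj w) := by
  have hw' := star_dotProduct_self_eq_zero.not.2 hw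
  constructor
  · rw [IsIdempotentElem, lineProj, smul_mul_smul_comm, vecMulVec_mul_vecMulVec, vecMulVec_smul,
      smul_smul]
    congr 1
    field_simp
  · obtain ⟨r, _, e⟩ := exists_star_dotProduct_self w
    rw [IsSelfAdjoint, lineProj, star_smul, e, star_eq_conjTranspose, conjTranspose_vecMulVec,
      star_star]
    simp

theorem continuousAt_lineProj (hv : v ≠ 0) : ContinuousAt (lineProj (m := m)) v := by
  have hv' := star_dotProduct_self_eq_zero.not.2 hv
  have h1 : Continuous fun w : m → ℂ => star w ⬝ᵥ w := by fun_prop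
  have h2 : Continuous fun w : m → ℂ => vecMulVec w (star w) := by fun_prop
  exact (h1.continuousAt.inv₀ hv').smul h2.continuousAt

theorem mul_lineProj {b : Matrix m m ℂ} {l : ℝ} (hv : b *ᵥ v = l • v) :
    b * lineProj v = l • lineProj v := by
  rw [lineProj, mul_smul_comm, mul_vecMulVec, hv, smul_comm, smul_vecMulVec]

variable [DecidableEq m]

/-- The compression of `b` to the orthogonal complement of the line spanned by `w`, with the
eigenvalue `l` on that line. -/
noncomputable def pinch (b : Matrix m m ℂ) (l : ℝ) (w : m → ℂ) : Matrix m m ℂ :=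
  l • lineProj w + (1 - lineProj w) * b * (1 - lineProj w)

theorem isSelfAdjoint_pinch {b : Matrix m m ℂ} (hb : IsSelfAdjoint b) (l : ℝ) (hw : w ≠ 0) :
    IsSelfAdjoint (pinch b l w) := by
  have hp := (isStarProjection_lineProj hw).isSelfAdjoint
  have hq : IsSelfAdjoint (1 - lineProj w) := (IsSelfAdjoint.one _).sub hp
  refine ((IsSelfAdjoint.all l).smul hp).add ?_
  simpa [hq.star_eq] using hb.conjugate (1 - lineProj w)

theorem pinch_mulVec_self (b : Matrix m m ℂ) (l : ℝ) (hw : w ≠ 0) :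
    pinch b l w *ᵥ w = l • w := by
  rw [pinch, add_mulVec, ← mulVec_mulVec, sub_mulVec, one_mulVec, smul_mulVec,
    lineProj_mulVec_self hw, sub_self, mulVec_zero, add_zero]

theorem pinch_mulVec_of_orthogonal (b : Matrix m m ℂ) (l : ℝ) {u : m → ℂ}
    (h : star w ⬝ᵥ u = 0) : pinch b l w *ᵥ u = (1 - lineProj w) *ᵥ (b *ᵥ u) := by
  rw [pinch, add_mulVec, ← mulVec_mulVec, sub_mulVec, one_mulVec, smul_mulVec,
    lineProj_mulVec_of_orthogonal h, sub_zero, smul_zero, zero_add, mulVec_mulVec]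

/-- At an eigenvector, pinching only shifts one eigenvalue. By continuity, pinching at nearby
vectors is a small perturbation when the shift is small. -/
theorem pinch_of_eigenvector {b : Matrix m m ℂ} (hb : IsSelfAdjoint b) {l : ℝ} (hv0 : v ≠ 0)
    (hv : b *ᵥ v = l • v) (s : ℝ) : pinch b s v = b + (s - l) • lineProj v := by
  have hp := isStarProjection_lineProj hv0
  have h1 := mul_lineProj hv
  have h2 : lineProj v * b = l • lineProj v := by
    have := congrArg star h1
    simpa [hp.isSelfAdjoint.star_eq, hb.star_eq] using this
  rw [pinch, sub_mul, one_mul, mul_sub, mul_one, sub_mul, h1, h2, smul_mul_assoc,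
    hp.isIdempotentElem, sub_smul]
  abel

theorem pinch_mul_one_sub (b : Matrix m m ℂ) (l : ℝ) (hw : w ≠ 0) :
    pinch b l w * (1 - lineProj w) = (1 - lineProj w) * pinch b l w := by
  have hp := (isStarProjection_lineProj hw).isIdempotentElem
  have hq := hp.one_sub
  rw [pinch, add_mul, mul_add, mul_assoc, hq.eq, ← mul_assoc, ← mul_assoc, hq.eq,
    smul_mul_assoc, mul_smul_comm, hp.mul_one_sub_self, hp.one_sub_mul_self]

/-- On the complement of w the pinched matrix has the Rayleigh quotients of b, hence no eigenvalue
above the bound for b. -/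
theorem le_of_pinch_mulVec {b : Matrix m m ℂ} (hb : IsSelfAdjoint b) {c l s : ℝ}
    (hc : ∀ t ∈ spectrum ℝ b, t ≤ c) {u : m → ℂ} (hwu : star w ⬝ᵥ u = 0) (hu : u ≠ 0)
    (h : pinch b l w *ᵥ u = s • u) : s ≤ c := by
  have h1 := congrArg (star u ⬝ᵥ ·) h
  have h2 := re_star_dotProduct_mulVec_le hb hc u
  have huw : star u ⬝ᵥ w = 0 := by rw [← star_star w, star_dotProduct_star, hwu, star_zero]
  simp only [pinch_mulVec_of_orthogonal b l hwu, sub_mulVec, one_mulVec, lineProj_mulVec,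
    dotProduct_sub, dotProduct_smul, huw, smul_zero, sub_zero] at h1
  rw [h1, Complex.real_smul, Complex.re_ofReal_mul] at h2
  exact le_of_mul_le_mul_right h2 (re_star_dotProduct_self_pos hu)

theorem continuousAt_pinch (b : Matrix m m ℂ) (l : ℝ) (hv : v ≠ 0) :
    ContinuousAt (pinch b l) v := by
  have h := continuousAt_lineProj hv
  have h' : ContinuousAt (fun w => 1 - lineProj w) v := continuousAt_const.sub h
  exact (h.const_smul l).add ((h'.mul continuousAt_const).mul h')

end LineProjection

/-! ### Separating two blocks by a projection; the order on blocks. -/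

section Separation

variable {P : Type*} [Fintype P] [DecidableEq P] {n : P → ℕ} {I : Set (BlockMatrix n)}

/-- `b` is an interior point of `I` relative to the self-adjoint block matrices, with radius `δ`. -/
def IsInteriorPoint (I : Set (BlockMatrix n)) (δ : ℝ) (b : BlockMatrix n) : Prop :=
  ∀ h : BlockMatrix n, IsSelfAdjoint h → ‖h‖ ≤ δ → b + h ∈ I

omit [Fintype P] in
theorem isSelfAdjoint_single {x : P} {h : Matrix (Fin (n x)) (Fin (n x)) ℂ}
    (hh : IsSelfAdjoint h) : IsSelfAdjoint (Pi.single x h : BlockMatrix n) := by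
  rw [IsSelfAdjoint, ← Pi.single_star, hh.star_eq]

namespace IsInteriorPoint

variable {δ : ℝ} {b : BlockMatrix n}

omit [DecidableEq P] in
theorem mem (hb : IsInteriorPoint I δ b) (hδ : 0 ≤ δ) : b ∈ I := by
  simpa using hb 0 (.zero _) (by simpa using hδ)

theorem add_single_mem (hb : IsInteriorPoint I δ b) {x : P}
    {h : Matrix (Fin (n x)) (Fin (n x)) ℂ} (hh : IsSelfAdjoint h) (hn : ‖h‖ ≤ δ) :
    b + Pi.single x h ∈ I :=
  hb _ (isSelfAdjoint_single hh) (by rwa [Pi.norm_single])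

theorem update (hb : IsInteriorPoint I δ b) {x : P}
    {c : Matrix (Fin (n x)) (Fin (n x)) ℂ} (hc : IsSelfAdjoint (c - b x))
    (hn : ‖c - b x‖ ≤ δ / 2) : IsInteriorPoint I (δ / 2) (Function.update b x c) := by
  have h : Function.update b x c = b + Pi.single x (c - b x) := by
    funext y
    by_cases hy : y = x
    · subst hy; simp
    · simp [hy]
  intro k hk hkn
  rw [h, add_assoc]
  refine hb _ ((isSelfAdjoint_single hc).add hk) ((norm_add_le _ _).trans ?_)
  rw [Pi.norm_single]
  linarith

end IsInteriorPoint

namespace IsIsocone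

variable {δ : ℝ} {b : BlockMatrix n}

omit [DecidableEq P] in
theorem add_isInteriorPoint (hI : IsIsocone I) {a : BlockMatrix n} (ha : a ∈ I)
    (hb : IsInteriorPoint I δ b) : IsInteriorPoint I δ (a + b) := fun h hh hn => by
  rw [add_assoc]
  exact hI.add_mem _ ha _ (hb h hh hn)

/-- Near an eigenvector of a block of an interior point, all vectors are eigenvectors, for the same
eigenvalue, of that block of interior points of the isocone. -/
theorem eventually_isInteriorPoint_update (hI : IsIsocone I) (hδ : 0 < δ)
    (hb : IsInteriorPoint I δ b) {x : P} {v : Fin (n x) → ℂ} (hv : v ≠ 0) {l : ℝ}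
    (hbv : b x *ᵥ v = l • v) {s : ℝ} (hs : ‖(s - l) • lineProj v‖ < δ / 2) :
    ∀ᶠ w in nhds v, w ≠ 0 ∧
      IsInteriorPoint I (δ / 2) (Function.update b x (pinch (b x) s w)) := by
  have hsa := hI.isSelfAdjoint_apply (hb.mem hδ.le) x
  have hc : ContinuousAt (fun w => ‖pinch (b x) s w - b x‖) v :=
    ((continuousAt_pinch (b x) s hv).sub continuousAt_const).norm
  have h1 : ∀ᶠ w in nhds v, ‖pinch (b x) s w - b x‖ < δ / 2 := by
    refine hc.eventually_lt continuousAt_const ?_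
    rwa [pinch_of_eigenvector hsa hv hbv, add_sub_cancel_left]
  filter_upwards [h1, isOpen_ne.mem_nhds hv] with w hw hw0
  exact ⟨hw0, hb.update ((isSelfAdjoint_pinch hsa s hw0).sub hsa) hw.le⟩

/-- Tilting v to v + εz inside block x and cutting at t gives projections of I that fix v + εz and
still kill w. The join over z = 0 and all basis vectors z fixes v and hence the whole block. -/
theorem exists_projection_eq_one_and_mulVec_eq_zero (hI : IsIsocone I) (hδ : 0 < δ)
    (hb : IsInteriorPoint I δ b) {x y : P} (hxy : x ≠ y) {v : Fin (n x) → ℂ} (hv : v ≠ 0)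
    {w : Fin (n y) → ℂ} {s t : ℝ} (hbv : b x *ᵥ v = s • v) (hbw : b y *ᵥ w = t • w)
    (hst : t < s) : ∃ e ∈ projections I, e x = 1 ∧ e y *ᵥ w = 0 := by
  have hev := hI.eventually_isInteriorPoint_update hδ hb hv hbv (s := s) (by simpa using hδ)
  have key : ∀ z : Fin (n x) → ℂ, ∃ ε : ℝ, 0 < ε ∧ ∃ r ∈ projections I,
      r x *ᵥ (v + ε • z) = v + ε • z ∧ r y *ᵥ w = 0 := by
    intro z
    obtain ⟨ε, hε, h0, hint⟩ := exists_pos_add_smul hev z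
    have hmem := hint.mem (by positivity)
    refine ⟨ε, hε, _, hI.upperProj_mem_projections hmem t, ?_, ?_⟩
    · refine upperProj_mulVec_of_lt (hI.isSelfAdjoint_apply hmem x) (l := s) ?_ hst
      rw [Function.update_self, pinch_mulVec_self _ _ h0]
    · refine upperProj_mulVec_of_le (hI.isSelfAdjoint_apply hmem y) (l := t) ?_ le_rfl
      rw [Function.update_of_ne hxy.symm, hbw]
  choose ε hε r hr hr1 hr2 using key
  -- `none` stands for the untilted vector.
  let z : Option (Fin (n x)) → (Fin (n x) → ℂ) := fun o => o.elim 0 fun i => Pi.single i 1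
  obtain ⟨e, he, h⟩ := hI.exists_finset_join Finset.univ (fun o => r (z o)) fun o _ => hr _
  refine ⟨e, he, ?_, (h y w).2 fun o _ => hr2 _⟩
  have hz : ∀ o, e x *ᵥ (v + ε (z o) • z o) = v + ε (z o) • z o := fun o =>
    (h x _).1 o (Finset.mem_univ o) (hr1 _)
  have hv' : e x *ᵥ v = v := by simpa [z] using hz none
  refine Matrix.ext_of_mulVec_single fun i => ?_
  have hi := hz (some i)
  rw [mulVec_add, hv', mulVec_smul] at hi
  have := smul_right_injective _ (hε _).ne' (add_left_cancel hi)
  rwa [one_mulVec]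

/-- The dual tilt, now of w in block y, uses up half the interior radius and leaves the other half
for the preceding lemma. The meet stays 1 on x and kills w and every basis vector on y. -/
theorem exists_projection_eq_one_and_eq_zero (hI : IsIsocone I) (hδ : 0 < δ)
    (hb : IsInteriorPoint I δ b) {x y : P} (hxy : x ≠ y) {v : Fin (n x) → ℂ} (hv : v ≠ 0)
    {w : Fin (n y) → ℂ} (hw : w ≠ 0) {s t : ℝ} (hbv : b x *ᵥ v = s • v) (hbw : b y *ᵥ w = t • w)
    (hst : t < s) : ∃ e ∈ projections I, e x = 1 ∧ e y = 0 := by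
  have hev := hI.eventually_isInteriorPoint_update hδ hb hw hbw (s := t) (by simpa using hδ)
  have key : ∀ z : Fin (n y) → ℂ, ∃ ε : ℝ, 0 < ε ∧ ∃ r ∈ projections I,
      r x = 1 ∧ r y *ᵥ (w + ε • z) = 0 := by
    intro z
    obtain ⟨ε, hε, h0, hint⟩ := exists_pos_add_smul hev z
    refine ⟨ε, hε, hI.exists_projection_eq_one_and_mulVec_eq_zero (half_pos hδ) hint hxy hv
      (s := s) (t := t) ?_ ?_ hst⟩
    · rw [Function.update_of_ne hxy, hbv]
    · rw [Function.update_self, pinch_mulVec_self _ _ h0]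
  choose ε hε r hr hr1 hr2 using key
  let z : Option (Fin (n y)) → (Fin (n y) → ℂ) := fun o => o.elim 0 fun i => Pi.single i 1
  obtain ⟨e, he, h⟩ := hI.exists_finset_meet Finset.univ (fun o => r (z o)) fun o _ => hr _
  refine ⟨e, he, ?_, ?_⟩
  · refine Matrix.ext_of_mulVec_single fun i => ?_
    rw [one_mulVec]
    exact (h x _).2 fun o _ => by rw [hr1, one_mulVec]
  have hz : ∀ o, e y *ᵥ (w + ε (z o) • z o) = 0 := fun o =>
    (h y _).1 o (Finset.mem_univ o) (hr2 _)
  have hw' : e y *ᵥ w = 0 := by simpa [z] using hz none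
  refine Matrix.ext_of_mulVec_single fun i => ?_
  have hi := hz (some i)
  rw [mulVec_add, hw', mulVec_smul, zero_add, smul_eq_zero] at hi
  rw [zero_mulVec]
  exact hi.resolve_left (hε _).ne'

omit [DecidableEq P] in
theorem exists_isInteriorPoint (hI : IsIsocone I) : ∃ b, ∃ δ > 0, IsInteriorPoint I δ b := by
  obtain ⟨b, _, δ, hδ, h⟩ := hI.exists_interior
  exact ⟨b, δ, hδ, h⟩

theorem exists_projection_of_spectrum_lt (hI : IsIsocone I) {a : BlockMatrix n} (ha : a ∈ I)
    {x y : P} (hxy : x ≠ y) {s t : ℝ} (hs : s ∈ spectrum ℝ (a x)) (ht : t ∈ spectrum ℝ (a y))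
    (hst : t < s) : ∃ e ∈ projections I, e x = 1 ∧ e y = 0 := by
  obtain ⟨b, δ, hδ, hb⟩ := hI.exists_isInteriorPoint
  have hbI := hb.mem hδ.le
  obtain ⟨v, hv, hav⟩ := (mem_spectrum_iff_eigenvector (hI.isSelfAdjoint_apply ha x)).1 hs
  obtain ⟨w, hw, haw⟩ := (mem_spectrum_iff_eigenvector (hI.isSelfAdjoint_apply ha y)).1 ht
  have hvpos := re_star_dotProduct_self_pos hv
  have hwpos := re_star_dotProduct_self_pos hw
  set α := (star v ⬝ᵥ (b x *ᵥ v)).re / (star v ⬝ᵥ v).re with hα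
  set β := (star w ⬝ᵥ (b y *ᵥ w)).re / (star w ⬝ᵥ w).re with hβ
  rw [eq_div_iff hvpos.ne'] at hα
  rw [eq_div_iff hwpos.ne'] at hβ
  -- `a` itself need not be interior, but `M • a + b` is. A large `M` keeps its Rayleigh quotients
  -- at `v` and `w` in the order of `s` and `t`, which forces eigenvalues on both sides of a number
  -- `c` in between.
  obtain ⟨M, hM0, hM⟩ : ∃ M : ℝ, 0 ≤ M ∧ M * t + β < M * s + α := by
    refine ⟨max 0 ((β - α + 1) / (s - t)), le_max_left _ _, ?_⟩
    have h1 : (β - α + 1) ≤ max 0 ((β - α + 1) / (s - t)) * (s - t) :=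
      (div_le_iff₀ (sub_pos.2 hst)).1 (le_max_right _ _)
    linarith
  have hint := hI.add_isInteriorPoint (hI.smul_mem hM0 ha) hb
  have hmem := hint.mem hδ.le
  set d : BlockMatrix n := M • a + b with hd
  obtain ⟨c, hc1, hc2⟩ := exists_between hM
  have hdx : ∃ l ∈ spectrum ℝ (d x), c < l := by
    by_contra! hcon
    have := re_star_dotProduct_mulVec_le (hI.isSelfAdjoint_apply hmem x) hcon v
    rw [hd, Pi.add_apply, Pi.smul_apply, add_mulVec, smul_mulVec, hav, smul_smul, dotProduct_add,
      dotProduct_smul, Complex.add_re, Complex.real_smul, Complex.re_ofReal_mul, ← hα,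
      ← add_mul] at this
    exact absurd (le_of_mul_le_mul_right this hvpos) hc2.not_ge
  have hdy : ∃ l ∈ spectrum ℝ (d y), l < c := by
    by_contra! hcon
    have := le_re_star_dotProduct_mulVec (hI.isSelfAdjoint_apply hmem y) hcon w
    rw [hd, Pi.add_apply, Pi.smul_apply, add_mulVec, smul_mulVec, haw, smul_smul, dotProduct_add,
      dotProduct_smul, Complex.add_re, Complex.real_smul, Complex.re_ofReal_mul, ← hβ,
      ← add_mul] at this
    exact absurd (le_of_mul_le_mul_right this hwpos) hc1.not_ge
  obtain ⟨l, hl, hcl⟩ := hdx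
  obtain ⟨k, hk, hck⟩ := hdy
  obtain ⟨v', hv', hdv⟩ := (mem_spectrum_iff_eigenvector (hI.isSelfAdjoint_apply hmem x)).1 hl
  obtain ⟨w', hw', hdw⟩ := (mem_spectrum_iff_eigenvector (hI.isSelfAdjoint_apply hmem y)).1 hk
  exact hI.exists_projection_eq_one_and_eq_zero hδ hint hxy hv' hw' hdv hdw (hck.trans hcl)

omit [DecidableEq P] in
theorem spectrum_nonempty (hI : IsIsocone I) {a : BlockMatrix n} (ha : a ∈ I) {x : P}
    (hn : 0 < n x) : (spectrum ℝ (a x)).Nonempty := by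
  have : Nonempty (Fin (n x)) := ⟨⟨0, hn⟩⟩
  have h : (a x).IsHermitian := hI.isSelfAdjoint_apply ha x
  rw [h.spectrum_real_eq_range_eigenvalues]
  exact Set.range_nonempty _

/-- The order on the blocks: `x ≺ y` when every element of `I` is at most as large on the block `x`
as it is on the block `y`. -/
@[reducible]
def blockOrder (hI : IsIsocone I) (hn : ∀ x, 0 < n x) : PartialOrder P where
  le x y := x = y ∨ ∀ a ∈ I, ∀ s ∈ spectrum ℝ (a x), ∀ t ∈ spectrum ℝ (a y), s ≤ t
  le_refl x := .inl rfl
  le_trans x y z := by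
    rintro (rfl | hxy) (rfl | hyz)
    · exact .inl rfl
    · exact .inr hyz
    · exact .inr hxy
    · refine .inr fun a ha s hs t ht => ?_
      obtain ⟨r, hr⟩ := hI.spectrum_nonempty ha (hn y)
      exact (hxy a ha s hs r hr).trans (hyz a ha r hr t ht)
  le_antisymm x y := by
    rintro (rfl | hxy) (h | hyx)
    · rfl
    · rfl
    · exact h.symm
    -- If both comparisons held, raising block `x` of an interior point by a small scalar would
    -- contradict one of them.
    · by_contra hne
      obtain ⟨b, δ, hδ, hb⟩ := hI.exists_isInteriorPoint
      have hbI := hb.mem hδ.le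
      obtain ⟨s, hs⟩ := hI.spectrum_nonempty hbI (hn x)
      obtain ⟨t, ht⟩ := hI.spectrum_nonempty hbI (hn y)
      obtain ⟨v, hv, hbv⟩ := (mem_spectrum_iff_eigenvector (hI.isSelfAdjoint_apply hbI x)).1 hs
      obtain ⟨ε, hε, hεδ⟩ : ∃ ε : ℝ, 0 < ε ∧ ‖ε • (1 : Matrix (Fin (n x)) (Fin (n x)) ℂ)‖ ≤ δ := by
        refine ⟨δ / (‖(1 : Matrix (Fin (n x)) (Fin (n x)) ℂ)‖ + 1), by positivity, ?_⟩
        rw [norm_smul, Real.norm_of_nonneg (by positivity), div_mul_eq_mul_div,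
          div_le_iff₀ (by positivity)]
        nlinarith [norm_nonneg (1 : Matrix (Fin (n x)) (Fin (n x)) ℂ)]
      have hmem := hb.add_single_mem ((IsSelfAdjoint.all ε).smul (IsSelfAdjoint.one _)) hεδ
      have h1 := hxy _ hmem (s + ε) ((mem_spectrum_iff_eigenvector
        (hI.isSelfAdjoint_apply hmem x)).2 ⟨v, hv, by
          rw [Pi.add_apply, Pi.single_eq_same, add_mulVec, smul_mulVec, one_mulVec, hbv,
            add_smul]⟩) t (by rwa [Pi.add_apply, Pi.single_eq_of_ne (Ne.symm hne), add_zero])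
      have h2 := hyx b hbI t ht s hs
      linarith

/-- Comparable blocks are comparable on all elements; incomparable ones are separated by a
projection. -/
theorem le_of_blockOrder_lt (hI : IsIsocone I) (hn : ∀ x, 0 < n x) {x y : P}
    (h : (hI.blockOrder hn).lt x y) {a : BlockMatrix n} (ha : a ∈ I) {s t : ℝ}
    (hs : s ∈ spectrum ℝ (a x)) (ht : t ∈ spectrum ℝ (a y)) : s ≤ t := by
  let _ := hI.blockOrder hn
  have h' : x < y := h
  rcases h'.le with h1 | h1
  · exact absurd h1 h'.ne
  · exact h1 a ha s hs t ht

theorem exists_projection_of_not_blockOrder_lt (hI : IsIsocone I) (hn : ∀ x, 0 < n x) {x y : P}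
    (hxy : x ≠ y) (h : ¬ (hI.blockOrder hn).lt x y) :
    ∃ e ∈ projections I, e x = 1 ∧ e y = 0 := by
  let _ := hI.blockOrder hn
  have h' : ¬ x ≤ y := fun hle => h (lt_of_le_of_ne hle hxy)
  have h2 := not_or.1 h'
  push Not at h2
  obtain ⟨-, a, ha, s, hs, t, ht, hst⟩ := h2
  exact hI.exists_projection_of_spectrum_lt ha hxy hs ht hst

end IsIsocone

end Separation

/-! ### An isocone is the lexicographic sum of its blocks. -/

section LexSum

theorem upperProj_eq_zero {m : Type*} [Fintype m] [DecidableEq m] {a : Matrix m m ℂ}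
    (ha : IsSelfAdjoint a) {c : ℝ} (h : ∀ l ∈ spectrum ℝ a, l ≤ c) : upperProj c a = 0 := by
  refine ext_of_eigenvectors ha fun l v hv => ?_
  by_cases hv0 : v = 0
  · simp [hv0]
  · rw [upperProj_mulVec_of_le ha hv (h l ((mem_spectrum_iff_eigenvector ha).2 ⟨v, hv0, hv⟩)),
      zero_mulVec]

theorem upperProj_eq_one {m : Type*} [Fintype m] [DecidableEq m] {a : Matrix m m ℂ}
    (ha : IsSelfAdjoint a) {c : ℝ} (h : ∀ l ∈ spectrum ℝ a, c < l) : upperProj c a = 1 := by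
  refine ext_of_eigenvectors ha fun l v hv => ?_
  by_cases hv0 : v = 0
  · simp [hv0]
  · rw [upperProj_mulVec_of_lt ha hv (h l ((mem_spectrum_iff_eigenvector ha).2 ⟨v, hv0, hv⟩)),
      one_mulVec]

variable {k : ℕ} {n : Fin k → ℕ} {I : Set (BlockMatrix n)}

namespace IsIsocone

/-- A projection that is blockwise in the isocone belongs to it as soon as each of its blocks lies
above a projection of the isocone with that block, up to smaller projections elsewhere. -/
theorem mem_of_forall_pair (hI : IsIsocone I) {p : BlockMatrix n}
    (hp : ∀ x, IsStarProjection (p x))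
    (h : ∀ x y, ∃ q ∈ projections I, (∀ u, p x *ᵥ u = u → q x *ᵥ u = u) ∧
      ∀ u, p y *ᵥ u = 0 → q y *ᵥ u = 0) : p ∈ I := by
  choose q hq hq1 hq0 using h
  -- For fixed `x`, the meet over `y` keeps the range of `p x` and vanishes on the kernel of every
  -- `p y`. The join over `x` then has the range and kernel of `p` in each block.
  have hmeet : ∀ x, ∃ r ∈ projections I, (∀ u, p x *ᵥ u = u → r x *ᵥ u = u) ∧
      ∀ y u, p y *ᵥ u = 0 → r y *ᵥ u = 0 := by
    intro x
    obtain ⟨r, hr, h⟩ := hI.exists_finset_meet Finset.univ (q x) fun y _ => hq x y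
    exact ⟨r, hr, fun u hu => (h x u).2 fun y _ => hq1 x y u hu,
      fun y u hu => (h y u).1 y (Finset.mem_univ _) (hq0 x y u hu)⟩
  choose r hr hr1 hr0 using hmeet
  obtain ⟨e, he, h⟩ := hI.exists_finset_join Finset.univ r fun x _ => hr x
  suffices e = p from this ▸ he.1
  funext x
  exact (hp x).eq_of_mulVec (fun u hu => (h x u).1 x (Finset.mem_univ _) (hr1 x u hu))
    fun u hu => (h x u).2 fun y _ => hr0 y x u hu

/-- It suffices to dominate each spectral projection p of b on pairs of blocks. If x = y, a lift of
`p x` works. If x ≺ y, either `p x = 0`, or b has an eigenvalue above c on x, so that `p y = 1` and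
its kernel imposes nothing. Otherwise the lift is met with a projection equal to 1 on x and 0 on y.
-/
theorem eq_lexSum (hI : IsIsocone I) (hn : ∀ x, 0 < n x) :
    I = lexSum (hI.blockOrder hn) (fun x => (fun a => a x) '' I) := by
  refine Set.Subset.antisymm (fun a ha => ⟨fun x => ⟨a, ha, rfl⟩, fun x y hxy s hs t ht =>
    hI.le_of_blockOrder_lt hn hxy ha hs ht⟩) ?_
  rintro b ⟨hb1, hb2⟩
  choose a ha hab using hb1
  have hsa : ∀ x, IsSelfAdjoint (b x) := fun x => hab x ▸ hI.isSelfAdjoint_apply (ha x) x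
  refine hI.mem_of_upperProj_mem (funext hsa) fun c => ?_
  refine hI.mem_of_forall_pair (fun x => isStarProjection_upperProj (hsa x) c) fun x y => ?_
  have hq : ∃ q ∈ projections I, q x = upperProj c (b x) :=
    ⟨_, hI.upperProj_mem_projections (ha x) c, congrArg (upperProj c) (hab x)⟩
  obtain ⟨q, hq, hqx⟩ := hq
  rw [← hqx]
  by_cases hxy : x = y
  · subst hxy
    exact ⟨q, hq, fun u hu => hu, fun u hu => by rwa [hqx]⟩
  by_cases hlt : (hI.blockOrder hn).lt x y
  · by_cases hx : ∀ l ∈ spectrum ℝ (b x), l ≤ c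
    · refine ⟨0, hI.zero_mem_projections, fun u hu => ?_, fun u _ => by simp⟩
      rw [hqx, upperProj_eq_zero (hsa x) hx, zero_mulVec] at hu
      simpa using hu
    · push Not at hx
      obtain ⟨s, hs, hcs⟩ := hx
      refine ⟨q, hq, fun u hu => hu, fun u hu => ?_⟩
      rw [upperProj_eq_one (hsa y) fun t ht => hcs.trans_le (hb2 x y hlt s hs t ht),
        one_mulVec] at hu
      rw [hu, mulVec_zero]
  · obtain ⟨e, he, hex, hey⟩ := hI.exists_projection_of_not_blockOrder_lt hn hxy hlt
    obtain ⟨r, hr, h⟩ := hI.exists_meet hq he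
    exact ⟨r, hr, fun u hu => (h x u).2.2 hu (by rw [hex, one_mulVec]),
      fun u _ => (h y u).2.1 (by rw [hey, zero_mulVec])⟩

end IsIsocone

end LexSum

/-! ### Rank-one projections in a block of dimension at least three. -/

section Full

variable {P : Type*} [Fintype P] [DecidableEq P] {n : P → ℕ} {I : Set (BlockMatrix n)} {x : P}

theorem eq_lineProj_of_mulVec {m : Type*} [Fintype m] [DecidableEq m] {p : Matrix m m ℂ}
    {z : m → ℂ} (hz : z ≠ 0) (h1 : p *ᵥ z = z) (h0 : ∀ u, star z ⬝ᵥ u = 0 → p *ᵥ u = 0) :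
    p = lineProj z := by
  refine (isStarProjection_lineProj hz).eq_of_mulVec (fun u hu => ?_) fun u hu => ?_
  · rw [lineProj_mulVec] at hu
    rw [← hu, mulVec_smul, h1]
  · rw [lineProj_mulVec, smul_eq_zero, mul_eq_zero, inv_eq_zero] at hu
    exact h0 u ((hu.resolve_right hz).resolve_left (star_dotProduct_self_eq_zero.not.2 hz))

/-- In dimension at least three there is a nonzero vector orthogonal to two given ones. -/
theorem exists_orthogonal {N : ℕ} (hN : 3 ≤ N) (v z : Fin N → ℂ) :
    ∃ t : Fin N → ℂ, t ≠ 0 ∧ star z ⬝ᵥ t = 0 ∧ star v ⬝ᵥ t = 0 := by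
  let f : (Fin N → ℂ) →ₗ[ℂ] (Fin 2 → ℂ) := (Matrix.of ![star z, star v]).mulVecLin
  have hf : ∃ t ∈ LinearMap.ker f, t ≠ 0 := by
    refine (Submodule.ne_bot_iff _).1 (LinearMap.ker_ne_bot_of_finrank_lt ?_)
    simp
    omega
  obtain ⟨t, ht, ht0⟩ := hf
  have h := LinearMap.mem_ker.1 ht
  exact ⟨t, ht0, congrFun h 0, congrFun h 1⟩

namespace IsIsocone

/-- The top eigenvalue l of the block of an interior point is raised slightly along one eigenvector
v, which is then tilted to w. Only w lies above the cut at l. -/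
theorem exists_eventually_lineProj (hI : IsIsocone I) (hn : 0 < n x) :
    ∃ v : Fin (n x) → ℂ, ∀ᶠ w in nhds v, w ≠ 0 ∧ ∃ r ∈ projections I, r x = lineProj w := by
  obtain ⟨b, δ, hδ, hb⟩ := hI.exists_isInteriorPoint
  have hsa := hI.isSelfAdjoint_apply (hb.mem hδ.le) x
  obtain ⟨l, hl, hmax⟩ := (finite_real_spectrum (A := b x)).exists_maximalFor id _
    (hI.spectrum_nonempty (hb.mem hδ.le) hn)
  have hle : ∀ t ∈ spectrum ℝ (b x), t ≤ l := fun t ht =>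
    (le_total t l).elim id fun h => hmax ht h
  obtain ⟨v, hv, hbv⟩ := (mem_spectrum_iff_eigenvector hsa).1 hl
  obtain ⟨ε, hε, hεδ⟩ : ∃ ε : ℝ, 0 < ε ∧ ‖ε • lineProj v‖ < δ / 2 := by
    refine ⟨δ / 2 / (‖lineProj v‖ + 1), by positivity, ?_⟩
    rw [norm_smul, Real.norm_of_nonneg (by positivity), div_mul_eq_mul_div,
      div_lt_iff₀ (by positivity)]
    nlinarith [norm_nonneg (lineProj v)]
  refine ⟨v, ?_⟩
  filter_upwards [hI.eventually_isInteriorPoint_update hδ hb hv hbv (s := l + ε)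
    (by simpa using hεδ)] with w ⟨hw, hint⟩
  have hmem := hint.mem (by positivity)
  refine ⟨hw, _, hI.upperProj_mem_projections hmem l, ?_⟩
  have hd := hI.isSelfAdjoint_apply hmem x
  rw [Function.update_self] at hd
  simp only [Function.update_self]
  have h1 := pinch_mulVec_self (b x) (l + ε) hw
  refine eq_lineProj_of_mulVec hw (upperProj_mulVec_of_lt hd h1 (by linarith)) fun u hu => ?_
  -- The pinched matrix commutes with `1 - lineProj w`, so the part of an eigenvector orthogonal to
  -- `w` is zero or an eigenvector with eigenvalue at most `l`.
  have hproj : upperProj l (pinch (b x) (l + ε) w) * (1 - lineProj w) = 0 := by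
    refine ext_of_eigenvectors hd fun s y hy => ?_
    have hwy : star w ⬝ᵥ ((1 - lineProj w) *ᵥ y) = 0 := by
      rw [star_dotProduct_mulVec_of_isSelfAdjoint
        ((IsSelfAdjoint.one _).sub (isStarProjection_lineProj hw).isSelfAdjoint), sub_mulVec,
        one_mulVec, lineProj_mulVec_self hw, sub_self, star_zero, zero_dotProduct]
    have hqy : pinch (b x) (l + ε) w *ᵥ ((1 - lineProj w) *ᵥ y)
        = s • ((1 - lineProj w) *ᵥ y) := by
      rw [mulVec_mulVec, pinch_mul_one_sub _ _ hw, ← mulVec_mulVec, hy, mulVec_smul]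
    rw [← mulVec_mulVec, zero_mulVec]
    by_cases h0 : (1 - lineProj w) *ᵥ y = 0
    · rw [h0, mulVec_zero]
    · exact upperProj_mulVec_of_le hd hqy (le_of_pinch_mulVec hsa hle hwy h0 hqy)
  have := congrArg (· *ᵥ u) hproj
  simpa [← mulVec_mulVec, sub_mulVec, lineProj_mulVec_of_orthogonal hu] using this

/-- For t orthogonal to v and z, the spans of {v, z} and {v + εt, z} intersect exactly in the line
of z. For small ε they are joins of lines near v, namely v, v + εz and v + εt, v + ε(t + z). -/
theorem exists_lineProj (hI : IsIsocone I) (hn : 3 ≤ n x) {z : Fin (n x) → ℂ} (hz : z ≠ 0) :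
    ∃ r ∈ projections I, r x = lineProj z := by
  obtain ⟨v, hev⟩ := hI.exists_eventually_lineProj (x := x) (by omega)
  obtain ⟨t, ht0, hzt, hvt'⟩ := exists_orthogonal hn v z
  have hev' := fun w => (tendsto_add_smul v w).eventually hev
  obtain ⟨ε, ⟨hε0, h1⟩, ⟨h2, h3⟩, hε⟩ := (((hev' 0).and (hev' z)).and
    (((hev' t).and (hev' (t + z))).and self_mem_nhdsWithin)).exists
  have hε' : (ε : ℂ) ≠ 0 := by exact_mod_cast (ne_of_gt hε : ε ≠ 0)
  rw [smul_zero, add_zero] at hε0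
  obtain ⟨hv, r₀, hr₀, e₀⟩ := hε0
  obtain ⟨hvz, r₁, hr₁, e₁⟩ := h1
  obtain ⟨hvt, r₂, hr₂, e₂⟩ := h2
  obtain ⟨hvtz, r₃, hr₃, e₃⟩ := h3
  obtain ⟨a, ha, hav⟩ := hI.exists_join hr₀ hr₁
  obtain ⟨b, hb, hbv⟩ := hI.exists_join hr₂ hr₃
  obtain ⟨c, hc, hcv⟩ := hI.exists_meet ha hb
  refine ⟨c, hc, eq_lineProj_of_mulVec hz ((hcv x z).2.2 ?_ ?_) fun u hu => ?_⟩
  · have f₀ := (hav x _).1 (by rw [e₀, lineProj_mulVec_self hv])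
    have f₁ := (hav x _).2.1 (by rw [e₁, lineProj_mulVec_self hvz])
    rw [mulVec_add, f₀, mulVec_smul] at f₁
    exact smul_right_injective _ (ne_of_gt hε) (add_left_cancel f₁)
  · have f₂ := (hbv x _).1 (by rw [e₂, lineProj_mulVec_self hvt])
    have f₃ := (hbv x _).2.1 (by rw [e₃, lineProj_mulVec_self hvtz])
    rw [smul_add, ← add_assoc, mulVec_add, f₂, mulVec_smul] at f₃
    exact smul_right_injective _ (ne_of_gt hε) (add_left_cancel f₃)
  · have ht := star_dotProduct_self_eq_zero.not.2 ht0
    have hwt : star (v + ε • t) ⬝ᵥ t = ε * (star t ⬝ᵥ t) := by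
      simp [hvt']
    -- This `α` splits `u` into `α • t`, orthogonal to the first span, and `u - α • t`, orthogonal
    -- to the second; the meet kills both.
    set α : ℂ := (star (v + ε • t) ⬝ᵥ u) / (ε * (star t ⬝ᵥ t)) with hα
    have hu1 : c x *ᵥ (α • t) = 0 := (hcv x _).1 ((hav x _).2.2
      (by rw [e₀]; exact lineProj_mulVec_of_orthogonal (by simp [hvt']))
      (by rw [e₁]; exact lineProj_mulVec_of_orthogonal (by simp [hvt', hzt])))
    have hperp : star (v + ε • t) ⬝ᵥ (u - α • t) = 0 := by
      rw [dotProduct_sub, dotProduct_smul, hwt, hα, smul_eq_mul,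
        div_mul_cancel₀ _ (mul_ne_zero hε' ht), sub_self]
    have hzperp : star z ⬝ᵥ (u - α • t) = 0 := by simp [hu, hzt]
    have hu2 : c x *ᵥ (u - α • t) = 0 := (hcv x _).2.1 ((hbv x _).2.2
      (by rw [e₂]; exact lineProj_mulVec_of_orthogonal hperp)
      (by
        rw [e₃]
        refine lineProj_mulVec_of_orthogonal ?_
        rw [smul_add, ← add_assoc, star_add, add_dotProduct, hperp, star_smul, smul_dotProduct,
          hzperp, smul_zero, add_zero]))
    rw [mulVec_sub, hu1, sub_zero] at hu2
    exact hu2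

end IsIsocone
end Full

/-! ### Hermitian 2 × 2 matrices and cones over subsets of the sphere. -/

section Bloch

/-- Half of the trace of a `2 × 2` Hermitian matrix. -/
noncomputable def blochMid (a : Matrix (Fin 2) (Fin 2) ℂ) : ℝ := ((a 0 0).re + (a 1 1).re) / 2

/-- Half of the spectral gap of a `2 × 2` Hermitian matrix. -/
noncomputable def blochRadius (a : Matrix (Fin 2) (Fin 2) ℂ) : ℝ :=
  √((((a 0 0).re - (a 1 1).re) / 2) ^ 2 + ((a 0 1).re ^ 2 + (a 0 1).im ^ 2))

/-- The spectral projection for the largest eigenvalue of a `2 × 2` Hermitian matrix that is not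
scalar. -/
noncomputable def blochDir (a : Matrix (Fin 2) (Fin 2) ℂ) : Matrix (Fin 2) (Fin 2) ℂ :=
  (1 / 2 : ℝ) • 1 + (1 / (2 * blochRadius a)) • (a - blochMid a • 1)

variable {a p : Matrix (Fin 2) (Fin 2) ℂ}

theorem continuous_blochMid : Continuous blochMid := by
  unfold blochMid
  fun_prop

theorem continuous_blochRadius : Continuous blochRadius := by
  unfold blochRadius
  fun_prop

theorem blochRadius_nonneg (a : Matrix (Fin 2) (Fin 2) ℂ) : 0 ≤ blochRadius a := Real.sqrt_nonneg _

theorem continuousAt_blochDir (h : blochRadius a ≠ 0) : ContinuousAt blochDir a := by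
  have h1 : ContinuousAt (fun b => 1 / (2 * blochRadius b)) a :=
    continuousAt_const.div (continuous_blochRadius.continuousAt.const_mul 2) (by positivity)
  have h2 : Continuous fun b : Matrix (Fin 2) (Fin 2) ℂ =>
      b - blochMid b • (1 : Matrix (Fin 2) (Fin 2) ℂ) :=
    continuous_id.sub (continuous_blochMid.smul continuous_const)
  exact continuousAt_const.add (h1.smul h2.continuousAt)

/-- Cayley–Hamilton for the traceless part; it makes `blochDir` idempotent. -/
theorem sub_blochMid_mul_self (ha : IsSelfAdjoint a) :
    (a - blochMid a • 1) * (a - blochMid a • 1) = (blochRadius a ^ 2) • 1 := by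
  have h10 : a 1 0 = star (a 0 1) := (congrFun (congrFun ha 1) 0).symm
  have h00 : (a 0 0).im = 0 := Complex.conj_eq_iff_im.1 (congrFun (congrFun ha 0) 0)
  have h11 : (a 1 1).im = 0 := Complex.conj_eq_iff_im.1 (congrFun (congrFun ha 1) 1)
  have hr : blochRadius a ^ 2
      = (((a 0 0).re - (a 1 1).re) / 2) ^ 2 + ((a 0 1).re ^ 2 + (a 0 1).im ^ 2) :=
    Real.sq_sqrt (by positivity)
  generalize blochRadius a ^ 2 = R at hr ⊢
  rw [blochMid]
  ext i j
  fin_cases i <;> fin_cases j <;> apply Complex.ext <;>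
    simp [Matrix.mul_apply, Fin.sum_univ_two, h10, h00, h11] <;> (try rw [hr]) <;> ring

theorem eq_of_blochRadius_eq_zero (ha : IsSelfAdjoint a) (h : blochRadius a = 0) :
    a = blochMid a • 1 := by
  have h1 := sub_blochMid_mul_self ha
  have hs : IsSelfAdjoint (a - blochMid a • (1 : Matrix (Fin 2) (Fin 2) ℂ)) :=
    ha.sub ((IsSelfAdjoint.all _).smul (IsSelfAdjoint.one _))
  rw [h, zero_pow two_ne_zero, zero_smul] at h1
  nth_rw 1 [← hs.star_eq] at h1
  exact sub_eq_zero.1 (CStarRing.star_mul_self_eq_zero_iff _ |>.1 h1)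

theorem eq_smul_blochDir_add (h : blochRadius a ≠ 0) :
    a = (2 * blochRadius a) • blochDir a + (blochMid a - blochRadius a) • 1 := by
  rw [blochDir, smul_add, smul_smul, smul_smul, mul_one_div_cancel (by positivity), one_smul]
  module

theorem blochDir_mem (ha : IsSelfAdjoint a) (h : blochRadius a ≠ 0) :
    blochDir a ∈ projSphere := by
  refine ⟨((IsSelfAdjoint.all _).smul (IsSelfAdjoint.one _)).add ((IsSelfAdjoint.all _).smul
    (ha.sub ((IsSelfAdjoint.all _).smul (IsSelfAdjoint.one _)))), ?_, ?_⟩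
  · rw [blochDir, add_mul, mul_add, mul_add, smul_mul_smul_comm, smul_mul_smul_comm,
      smul_mul_smul_comm, smul_mul_smul_comm, sub_blochMid_mul_self ha, one_mul, mul_one, one_mul,
      smul_smul]
    have : 1 / (2 * blochRadius a) * (1 / (2 * blochRadius a)) * blochRadius a ^ 2 = 1 / 4 := by
      field_simp
      norm_num
    rw [this]
    module
  · have h00 : (a 0 0).im = 0 := Complex.conj_eq_iff_im.1 (congrFun (congrFun ha 0) 0)
    have h11 : (a 1 1).im = 0 := Complex.conj_eq_iff_im.1 (congrFun (congrFun ha 1) 1)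
    have : (a - blochMid a • (1 : Matrix (Fin 2) (Fin 2) ℂ)).trace = 0 := by
      apply Complex.ext <;> simp [blochMid, Matrix.trace, Fin.sum_univ_two, h00, h11]
      ring
    rw [blochDir, trace_add, trace_smul, trace_smul, this]
    simp [Matrix.trace]

theorem blochMid_smul_add (t s : ℝ) (a : Matrix (Fin 2) (Fin 2) ℂ) :
    blochMid (t • a + s • 1) = t * blochMid a + s := by
  simp [blochMid]
  ring

theorem blochRadius_smul_add {t : ℝ} (ht : 0 ≤ t) (s : ℝ) (a : Matrix (Fin 2) (Fin 2) ℂ) :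
    blochRadius (t • a + s • 1) = t * blochRadius a := by
  rw [← Real.sqrt_sq ht, blochRadius, blochRadius, ← Real.sqrt_mul (sq_nonneg t)]
  congr 1
  simp [Real.sqrt_sq ht]
  ring

theorem blochMid_of_mem (hp : p ∈ projSphere) : blochMid p = 1 / 2 := by
  have := congrArg Complex.re hp.2.2
  simp [Matrix.trace, Fin.sum_univ_two] at this
  simp [blochMid, this]

theorem blochRadius_of_mem (hp : p ∈ projSphere) : blochRadius p = 1 / 2 := by
  have h1 := sub_blochMid_mul_self hp.1
  have h2 : (p - (1 / 2 : ℝ) • 1) * (p - (1 / 2 : ℝ) • 1)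
      = (1 / 4 : ℝ) • (1 : Matrix (Fin 2) (Fin 2) ℂ) := by
    rw [sub_mul, mul_sub, mul_sub, hp.2.1, smul_mul_smul_comm, smul_mul_assoc, mul_smul_comm]
    simp only [mul_one, one_mul]
    module
  rw [blochMid_of_mem hp, h2] at h1
  have h3 := congrArg Complex.re (congrFun (congrFun h1 0) 0)
  simp only [Matrix.smul_apply, one_apply_eq, Complex.real_smul, mul_one, Complex.ofReal_re] at h3
  nlinarith [blochRadius_nonneg p]

theorem blochDir_of_mem (hp : p ∈ projSphere) : blochDir p = p := by
  rw [blochDir, blochMid_of_mem hp, blochRadius_of_mem hp]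
  module

theorem isStarProjection_of_mem (hp : p ∈ projSphere) : IsStarProjection p := ⟨hp.2.1, hp.1⟩

/-- The coefficients t and s are continuous functions of the matrix, so only p remains existential;
as p ranges over a compact set, closedness of the cone follows by projecting along it. -/
theorem coneOver_eq {K : Set (Matrix (Fin 2) (Fin 2) ℂ)} (hK : K ⊆ projSphere) :
    coneOver K = {a | ∃ p ∈ K, a = (2 * blochRadius a) • p + (blochMid a - blochRadius a) • 1} := by
  ext a
  constructor
  · rintro ⟨t, ht, p, hp, s, rfl⟩
    refine ⟨p, hp, ?_⟩
    rw [blochRadius_smul_add ht, blochMid_smul_add, blochRadius_of_mem (hK hp),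
      blochMid_of_mem (hK hp)]
    module
  · rintro ⟨p, hp, h⟩
    exact ⟨_, by have := blochRadius_nonneg a; positivity, p, hp, _, h⟩

theorem isClosed_coneOver {K : Set (Matrix (Fin 2) (Fin 2) ℂ)} (hK : K ⊆ projSphere)
    (hKc : IsCompact K) : IsClosed (coneOver K) := by
  have : CompactSpace K := isCompact_iff_compactSpace.1 hKc
  have hcl : IsClosed {q : Matrix (Fin 2) (Fin 2) ℂ × K |
      q.1 = (2 * blochRadius q.1) • (q.2 : Matrix (Fin 2) (Fin 2) ℂ)
        + (blochMid q.1 - blochRadius q.1) • (1 : Matrix (Fin 2) (Fin 2) ℂ)} := by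
    have h1 : Continuous fun q : Matrix (Fin 2) (Fin 2) ℂ × K => blochRadius q.1 :=
      continuous_blochRadius.comp continuous_fst
    have h2 : Continuous fun q : Matrix (Fin 2) (Fin 2) ℂ × K => blochMid q.1 :=
      continuous_blochMid.comp continuous_fst
    exact isClosed_eq continuous_fst (((continuous_const.mul h1).smul
      (continuous_subtype_val.comp continuous_snd)).add ((h2.sub h1).smul continuous_const))
  convert isClosedMap_fst_of_compactSpace _ hcl
  rw [coneOver_eq hK]
  ext a
  simp

theorem smul_mem_coneOver {K : Set (Matrix (Fin 2) (Fin 2) ℂ)} {r : ℝ} (hr : 0 ≤ r)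
    (ha : a ∈ coneOver K) : r • a ∈ coneOver K := by
  obtain ⟨t, ht, p, hp, s, rfl⟩ := ha
  exact ⟨r * t, mul_nonneg hr ht, p, hp, r * s, by rw [smul_add, smul_smul, smul_smul]⟩

/-- Seen from the center, the direction of tp + t'p' lies in the cone spanned by p and p', hence on
their smallest arc. Antipodal points need no arc, since p + p' = 1 lets the smaller coefficient
cancel. -/
theorem add_mem_coneOver {K : Set (Matrix (Fin 2) (Fin 2) ℂ)}
    (hKg : IsGeodesicallyConvex K) (hK : K ⊆ projSphere) {a b : Matrix (Fin 2) (Fin 2) ℂ}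
    (ha : a ∈ coneOver K) (hb : b ∈ coneOver K) : a + b ∈ coneOver K := by
  obtain ⟨t, ht, p, hp, s, rfl⟩ := ha
  obtain ⟨t', ht', p', hp', s', rfl⟩ := hb
  by_cases hpp : p' = 1 - p
  · rcases le_total t t' with h | h
    · refine ⟨t' - t, sub_nonneg.2 h, p', hp', s + s' + t, ?_⟩
      rw [show p = 1 - p' by rw [hpp]; abel]
      module
    · refine ⟨t - t', sub_nonneg.2 h, p, hp, s + s' + t', ?_⟩
      rw [hpp]
      module
  set c := t • p + t' • p' with hc
  have hsa : IsSelfAdjoint c := ((IsSelfAdjoint.all t).smul (hK hp).1).add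
    ((IsSelfAdjoint.all t').smul (hK hp').1)
  have hsum : t • p + s • 1 + (t' • p' + s' • 1) = c + (s + s') • 1 := by
    rw [hc]
    module
  rw [hsum]
  by_cases hr : blochRadius c = 0
  · refine ⟨0, le_rfl, p, hp, blochMid c + (s + s'), ?_⟩
    nth_rw 1 [eq_of_blochRadius_eq_zero hsa hr]
    module
  · have hrpos : 0 < blochRadius c := lt_of_le_of_ne (blochRadius_nonneg c) (Ne.symm hr)
    have hmid : blochMid c = (t + t') / 2 := by
      have h1 := blochMid_of_mem (hK hp)
      have h2 := blochMid_of_mem (hK hp')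
      unfold blochMid at h1 h2 ⊢
      simp [hc]
      linear_combination 2 * t * h1 + 2 * t' * h2
    have hz : blochDir c ∈ K := by
      refine hKg p hp p' hp' hpp _ (blochDir_mem hsa hr) ⟨t / (2 * blochRadius c),
        t' / (2 * blochRadius c), by positivity, by positivity, ?_⟩
      rw [blochDir, hmid, hc]
      module
    refine ⟨2 * blochRadius c, by positivity, _, hz, blochMid c - blochRadius c + (s + s'), ?_⟩
    nth_rw 1 [eq_smul_blochDir_add hr]
    module

theorem cfc_smul_add {m : Type*} [Fintype m] [DecidableEq m] {p : Matrix m m ℂ}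
    (hp : IsStarProjection p) (t s : ℝ) (f : ℝ → ℝ) :
    cfc f (t • p + s • 1) = (f (t + s) - f s) • p + f s • 1 := by
  have hsa : IsSelfAdjoint (t • p + s • (1 : Matrix m m ℂ)) :=
    ((IsSelfAdjoint.all t).smul hp.isSelfAdjoint).add
      ((IsSelfAdjoint.all s).smul (IsSelfAdjoint.one _))
  refine Matrix.ext_of_mulVec_single fun i => ?_
  set u : m → ℂ := Pi.single i 1
  have h1 := cfc_mulVec hsa f (v := p *ᵥ u) (l := t + s) (by
    rw [add_mulVec, smul_mulVec, smul_mulVec, hp.mulVec_mulVec, one_mulVec, add_smul])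
  have h0 := cfc_mulVec hsa f (v := u - p *ᵥ u) (l := s) (by
    rw [add_mulVec, smul_mulVec, smul_mulVec, mulVec_sub, hp.mulVec_mulVec, one_mulVec, sub_self,
      smul_zero, zero_add])
  rw [mulVec_sub, h1, sub_eq_iff_eq_add] at h0
  rw [h0, add_mulVec, smul_mulVec, smul_mulVec, one_mulVec]
  module

/-- Every Hermitian matrix is a difference of two elements of the cone over a subset of the sphere
with interior points. -/
theorem exists_sub_of_coneOver {K : Set (Matrix (Fin 2) (Fin 2) ℂ)}
    (hKi : (interior {p : projSphere | (p : Matrix (Fin 2) (Fin 2) ℂ) ∈ K}).Nonempty)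
    {c : Matrix (Fin 2) (Fin 2) ℂ} (hc : IsSelfAdjoint c) :
    ∃ a ∈ coneOver K, ∃ b ∈ coneOver K, c = a - b := by
  obtain ⟨p, hp⟩ := hKi
  have hp0 : blochRadius (p : Matrix (Fin 2) (Fin 2) ℂ) ≠ 0 := by
    rw [blochRadius_of_mem p.2]
    norm_num
  obtain ⟨U, hU, hUp⟩ := mem_nhds_subtype _ _ _ |>.1 (mem_interior_iff_mem_nhds.1 hp)
  -- For small `ε` the direction of `p + ε • c` stays in `K`, and `c` is the difference of `p + ε •
  -- c` and `p`, divided by `ε`.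
  have hlim : Filter.Tendsto (fun ε : ℝ => (p : Matrix (Fin 2) (Fin 2) ℂ) + ε • c)
      (nhdsWithin 0 (Set.Ioi 0)) (nhds p) := by
    have : Continuous fun ε : ℝ => (p : Matrix (Fin 2) (Fin 2) ℂ) + ε • c := by fun_prop
    simpa using this.continuousWithinAt.tendsto (x := (0 : ℝ)) (s := Set.Ioi 0)
  have h1 : ∀ᶠ b in nhds (p : Matrix (Fin 2) (Fin 2) ℂ), blochDir b ∈ U := by
    refine (continuousAt_blochDir hp0).eventually_mem ?_
    rwa [blochDir_of_mem p.2]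
  have h2 : ∀ᶠ b in nhds (p : Matrix (Fin 2) (Fin 2) ℂ), blochRadius b ≠ 0 :=
    continuous_blochRadius.continuousAt.eventually_ne hp0
  obtain ⟨ε, ⟨hεU, hεr⟩, hε⟩ :=
    ((hlim.eventually (h1.and h2)).and self_mem_nhdsWithin).exists
  have hε' : 0 < ε := hε
  set d := (p : Matrix (Fin 2) (Fin 2) ℂ) + ε • c with hd
  have hdsa : IsSelfAdjoint d := p.2.1.add ((IsSelfAdjoint.all ε).smul hc)
  have hdK : blochDir d ∈ K := hUp (show (⟨_, blochDir_mem hdsa hεr⟩ : projSphere) ∈ _ from hεU)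
  have hdc : d ∈ coneOver K := ⟨_, by have := blochRadius_nonneg d; positivity, _, hdK, _,
    eq_smul_blochDir_add hεr⟩
  have hpc : (p : Matrix (Fin 2) (Fin 2) ℂ) ∈ coneOver K :=
    ⟨1, zero_le_one, p, (interior_subset hp : p ∈ {p : projSphere | _}), 0, by simp⟩
  refine ⟨ε⁻¹ • d, smul_mem_coneOver (by positivity) hdc, ε⁻¹ • p,
    smul_mem_coneOver (by positivity) hpc, ?_⟩
  rw [hd, smul_add, smul_smul, inv_mul_cancel₀ hε'.ne']
  module

end Bloch

/-! ### Lexicographic sums of listed isocones are isocones. -/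

section Converse

theorem closure_sub_eq_selfAdjoint {A : Type*} [CStarAlgebra A] {I : Set A}
    (hsa : ∀ a ∈ I, IsSelfAdjoint a)
    (h : ∀ c : A, IsSelfAdjoint c → ∃ a ∈ I, ∃ b ∈ I, c = a - b) :
    closure {c : A | ∃ a ∈ I, ∃ b ∈ I, c = a - b} = {a : A | IsSelfAdjoint a} := by
  have : {c : A | ∃ a ∈ I, ∃ b ∈ I, c = a - b} = {a : A | IsSelfAdjoint a} := by
    ext c
    refine ⟨?_, h c⟩
    rintro ⟨a, ha, b, hb, rfl⟩
    exact (hsa a ha).sub (hsa b hb)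
  rw [this]
  exact (isClosed_eq continuous_star continuous_id).closure_eq

theorem isIsocone_isHermitian (N : ℕ) :
    IsIsocone {a : Matrix (Fin N) (Fin N) ℂ | a.IsHermitian} where
  selfAdjoint _ ha := ha
  const_mem r := (IsSelfAdjoint.all r).smul (IsSelfAdjoint.one (Matrix (Fin N) (Fin N) ℂ))
  add_mem _ ha _ hb := IsSelfAdjoint.add ha hb
  isotone_mem f _ _ a _ := cfc_predicate (p := IsSelfAdjoint) f a
  closed := isClosed_eq continuous_star continuous_id
  dense := closure_sub_eq_selfAdjoint (fun _ ha => ha) fun c hc =>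
    ⟨c, hc, 0, IsSelfAdjoint.zero _, by simp⟩

theorem isIsocone_coneOver {K : Set (Matrix (Fin 2) (Fin 2) ℂ)} (hKS : K ⊆ projSphere)
    (hKc : IsCompact K) (hKg : IsGeodesicallyConvex K)
    (hKi : (interior {p : projSphere | (p : Matrix (Fin 2) (Fin 2) ℂ) ∈ K}).Nonempty) :
    IsIsocone (coneOver K) := by
  have hsa : ∀ a ∈ coneOver K, IsSelfAdjoint a := by
    rintro _ ⟨t, _, p, hp, s, rfl⟩
    exact ((IsSelfAdjoint.all t).smul (hKS hp).1).add
      ((IsSelfAdjoint.all s).smul (IsSelfAdjoint.one _))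
  refine ⟨hsa, fun r => ?_, fun a ha b hb => add_mem_coneOver hKg hKS ha hb, ?_,
    isClosed_coneOver hKS hKc,
    closure_sub_eq_selfAdjoint hsa fun c hc => exists_sub_of_coneOver hKi hc⟩
  · obtain ⟨p, hp⟩ := hKi
    exact ⟨0, le_rfl, p, (interior_subset hp : p ∈ {p : projSphere | _}), r, by simp⟩
  · rintro f hf hm _ ⟨t, ht, p, hp, s, rfl⟩
    -- Monotonicity keeps the coefficient of `p` non-negative, so the direction `p` does not flip.
    refine ⟨f (t + s) - f s, sub_nonneg.2 (hm (by linarith)), p, hp, f s, ?_⟩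
    exact cfc_smul_add (isStarProjection_of_mem (hKS hp)) t s f

theorem IsListedIsocone.isIsocone {N : ℕ} {J : Set (Matrix (Fin N) (Fin N) ℂ)}
    (h : IsListedIsocone N J) : IsIsocone J := by
  cases h with
  | full N _ => exact isIsocone_isHermitian N
  | two K hKS hKc hKg hKi => exact isIsocone_coneOver hKS hKc hKg hKi

theorem IsListedIsocone.exists_sub {N : ℕ} {J : Set (Matrix (Fin N) (Fin N) ℂ)}
    (h : IsListedIsocone N J) {c : Matrix (Fin N) (Fin N) ℂ} (hc : IsSelfAdjoint c) :
    ∃ a ∈ J, ∃ b ∈ J, c = a - b := by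
  cases h with
  | full N _ => exact ⟨c, hc, 0, IsSelfAdjoint.zero _, by simp⟩
  | two K hKS hKc hKg hKi => exact exists_sub_of_coneOver hKi hc

theorem exists_separating_of_finite {S T : Set ℝ} (hS : S.Finite) (hT : T.Finite)
    (h : ∀ s ∈ S, ∀ t ∈ T, s ≤ t) : ∃ r, (∀ s ∈ S, s ≤ r) ∧ ∀ t ∈ T, r ≤ t := by
  rcases S.eq_empty_or_nonempty with rfl | hne
  · obtain ⟨r, hr⟩ := hT.bddBelow
    exact ⟨r, by simp, fun t ht => hr ht⟩
  · obtain ⟨r, hrS, hr⟩ := hS.exists_maximalFor id _ hne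
    exact ⟨r, fun s hs => (le_total s r).elim id fun h' => hr hs h', h r hrS⟩

/-- Every Rayleigh quotient of a is at most every one of b; with denominators cleared, the
inequalities are linear and continuous in (a, b), so they survive sums and limits. -/
theorem spectrum_le_spectrum_iff {m m' : Type*} [Fintype m] [DecidableEq m] [Fintype m']
    [DecidableEq m'] {a : Matrix m m ℂ} {b : Matrix m' m' ℂ} (ha : IsSelfAdjoint a)
    (hb : IsSelfAdjoint b) :
    (∀ s ∈ spectrum ℝ a, ∀ t ∈ spectrum ℝ b, s ≤ t) ↔ ∀ (v : m → ℂ) (w : m' → ℂ),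
      (star v ⬝ᵥ (a *ᵥ v)).re * (star w ⬝ᵥ w).re ≤ (star w ⬝ᵥ (b *ᵥ w)).re * (star v ⬝ᵥ v).re := by
  constructor
  · intro h v w
    obtain ⟨r, hr1, hr2⟩ := exists_separating_of_finite finite_real_spectrum
      finite_real_spectrum h
    have h1 := mul_le_mul_of_nonneg_right (re_star_dotProduct_mulVec_le ha hr1 v)
      (re_star_dotProduct_self_nonneg w)
    have h2 := mul_le_mul_of_nonneg_right (le_re_star_dotProduct_mulVec hb hr2 w)
      (re_star_dotProduct_self_nonneg v)
    linarith
  · intro h s hs t ht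
    obtain ⟨v, hv, hav⟩ := (mem_spectrum_iff_eigenvector ha).1 hs
    obtain ⟨w, hw, hbw⟩ := (mem_spectrum_iff_eigenvector hb).1 ht
    have h1 := h v w
    rw [hav, hbw, dotProduct_smul, dotProduct_smul, Complex.real_smul, Complex.real_smul,
      Complex.re_ofReal_mul, Complex.re_ofReal_mul, mul_assoc, mul_assoc,
      mul_comm (star w ⬝ᵥ w).re] at h1
    exact le_of_mul_le_mul_right h1
      (mul_pos (re_star_dotProduct_self_pos hv) (re_star_dotProduct_self_pos hw))

variable {P : Type*} [Fintype P] {n : P → ℕ} {J : ∀ x, Set (Matrix (Fin (n x)) (Fin (n x)) ℂ)}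

omit [Fintype P] in
theorem mem_lexSum_iff (ord : PartialOrder P) (hJ : ∀ x, ∀ a ∈ J x, IsSelfAdjoint a)
    {a : BlockMatrix n} : a ∈ lexSum ord J ↔ (∀ x, a x ∈ J x) ∧
      ∀ x y, ord.lt x y → ∀ (v : Fin (n x) → ℂ) (w : Fin (n y) → ℂ),
        (star v ⬝ᵥ (a x *ᵥ v)).re * (star w ⬝ᵥ w).re ≤
          (star w ⬝ᵥ (a y *ᵥ w)).re * (star v ⬝ᵥ v).re :=
  and_congr_right fun h => forall₃_congr fun x y _ =>
    spectrum_le_spectrum_iff (hJ x _ (h x)) (hJ y _ (h y))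

/-- Adding large multiples of a strictly increasing function brings a family of elements into the
lexicographic sum. -/
theorem exists_add_mem_lexSum (ord : PartialOrder P) (hJ : ∀ x, IsIsocone (J x)) {h : P → ℕ}
    (hh : ∀ x y, ord.lt x y → h x < h y) {a : BlockMatrix n} (ha : ∀ x, a x ∈ J x) :
    ∃ M₀ : ℝ, ∀ M, M₀ ≤ M → (a + fun x => (M * h x) • 1) ∈ lexSum ord J := by
  have hfin : (⋃ x, spectrum ℝ (a x)).Finite := Set.finite_iUnion fun x => finite_real_spectrum
  obtain ⟨u, hu⟩ := hfin.bddAbove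
  obtain ⟨l, hl⟩ := hfin.bddBelow
  -- Values of `h` on comparable blocks differ by at least 1, so a step of size `u - l` outweighs
  -- the whole spread of the spectra.
  refine ⟨max 0 (u - l), fun M hM => (mem_lexSum_iff ord fun x => (hJ x).selfAdjoint).2
    ⟨fun x => (hJ x).add_const_mem (ha x) _, fun x y hxy v w => ?_⟩⟩
  have hM0 : 0 ≤ M := (le_max_left _ _).trans hM
  have hMu : u - l ≤ M := (le_max_right _ _).trans hM
  have h1 := re_star_dotProduct_mulVec_le ((hJ x).selfAdjoint _ (ha x))
    (fun s hs => hu (Set.mem_iUnion.2 ⟨x, hs⟩)) v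
  have h2 := le_re_star_dotProduct_mulVec ((hJ y).selfAdjoint _ (ha y))
    (fun s hs => hl (Set.mem_iUnion.2 ⟨y, hs⟩)) w
  have hN := re_star_dotProduct_self_nonneg v
  have hN' := re_star_dotProduct_self_nonneg w
  have h3 : (h x : ℝ) + 1 ≤ h y := by exact_mod_cast hh x y hxy
  simp only [Pi.add_apply, add_mulVec, smul_mulVec, one_mulVec, dotProduct_add, dotProduct_smul,
    Complex.add_re, Complex.real_smul, Complex.re_ofReal_mul]
  have h4 : u + M * h x ≤ l + M * h y := by nlinarith
  calc _ ≤ ((u + M * h x) * (star v ⬝ᵥ v).re) * (star w ⬝ᵥ w).re := by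
        gcongr
        linarith
    _ ≤ ((l + M * h y) * (star w ⬝ᵥ w).re) * (star v ⬝ᵥ v).re := by
        rw [mul_right_comm]
        gcongr
    _ ≤ _ := by
        gcongr
        linarith

theorem isIsocone_lexSum (ord : PartialOrder P) (hJ : ∀ x, IsListedIsocone (n x) (J x)) :
    IsIsocone (lexSum ord J) := by
  classical
  have hJ' := fun x => (hJ x).isIsocone
  have hJsa := fun x => (hJ' x).selfAdjoint
  have hsa : ∀ a ∈ lexSum ord J, IsSelfAdjoint a := fun a ha =>
    funext fun x => hJsa x _ (ha.1 x)
  refine ⟨hsa, fun r => ?_, fun a ha b hb => ?_, fun f hf hm a ha => ?_, ?_,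
    closure_sub_eq_selfAdjoint hsa fun c hc => ?_⟩
  · refine (mem_lexSum_iff ord hJsa).2 ⟨fun x => (hJ' x).const_mem r, fun x y _ v w => ?_⟩
    simp only [Pi.smul_apply, Pi.one_apply, smul_mulVec, one_mulVec, dotProduct_smul,
      Complex.real_smul, Complex.re_ofReal_mul]
    exact (mul_right_comm _ _ _).le
  · rw [mem_lexSum_iff ord hJsa] at ha hb ⊢
    refine ⟨fun x => (hJ' x).add_mem _ (ha.1 x) _ (hb.1 x), fun x y hxy v w => ?_⟩
    simp only [Pi.add_apply, add_mulVec, dotProduct_add, Complex.add_re, add_mul]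
    exact add_le_add (ha.2 x y hxy v w) (hb.2 x y hxy v w)
  · have hx : ∀ x, cstarCfc f a x = cfc f (a x) := cfc_pi_apply (hsa a ha) hf
    have hspec : ∀ x, spectrum ℝ (cstarCfc f a x) = f '' spectrum ℝ (a x) := fun x => by
      rw [hx]
      exact cfc_map_spectrum f (a x) (hJsa x _ (ha.1 x)) hf.continuousOn
    refine ⟨fun x => ?_, fun x y hxy => ?_⟩
    · have := (hJ' x).isotone_mem f hf hm _ (ha.1 x)
      rwa [← hx x] at this
    · change ∀ s ∈ spectrum ℝ (cstarCfc f a x), ∀ t ∈ spectrum ℝ (cstarCfc f a y), s ≤ t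
      rw [hspec, hspec]
      rintro _ ⟨s, hs, rfl⟩ _ ⟨t, ht, rfl⟩
      exact hm (ha.2 x y hxy s hs t ht)
  · have : lexSum ord J = {a : BlockMatrix n | (∀ x, a x ∈ J x) ∧
        ∀ x y, ord.lt x y → ∀ (v : Fin (n x) → ℂ) (w : Fin (n y) → ℂ),
          (star v ⬝ᵥ (a x *ᵥ v)).re * (star w ⬝ᵥ w).re ≤
            (star w ⬝ᵥ (a y *ᵥ w)).re * (star v ⬝ᵥ v).re} :=
      Set.ext fun a => mem_lexSum_iff ord hJsa
    rw [this]
    simp only [Set.ofPred_and, Set.ofPred_forall]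
    refine IsClosed.inter (isClosed_iInter fun x => (hJ' x).closed.preimage (continuous_apply x))
      (isClosed_iInter fun x => isClosed_iInter fun y => isClosed_iInter fun _ =>
        isClosed_iInter fun v => isClosed_iInter fun w => ?_)
    have hcont : ∀ (x : P) (v : Fin (n x) → ℂ),
        Continuous fun a : BlockMatrix n => (star v ⬝ᵥ (a x *ᵥ v)).re := fun x v => by
      have h1 : Continuous fun a : Matrix (Fin (n x)) (Fin (n x)) ℂ => (star v ⬝ᵥ (a *ᵥ v)).re := by
        fun_prop
      exact h1.comp (continuous_apply x)
    exact isClosed_le ((hcont x v).mul continuous_const) ((hcont y w).mul continuous_const)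
  · choose a ha b hb hab using fun x => (hJ x).exists_sub (congrFun hc x : IsSelfAdjoint (c x))
    -- The size of the down-set is strictly increasing. The same multiple of it is added to both
    -- terms of a blockwise difference, which is therefore unchanged.
    let h : P → ℕ := fun x => (Finset.univ.filter fun z => ord.le z x).card
    have hh : ∀ x y, ord.lt x y → h x < h y := fun x y hxy => by
      refine Finset.card_lt_card (Finset.ssubset_iff_subset_ne.2 ⟨fun z hz => ?_, fun heq => ?_⟩)
      · simp only [Finset.mem_filter, Finset.mem_univ, true_and] at hz ⊢
        exact ord.le_trans _ _ _ hz hxy.le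
      · have : y ∈ Finset.univ.filter fun z => ord.le z x := by
          rw [heq]
          simp only [Finset.mem_filter, Finset.mem_univ, true_and]
          exact ord.le_refl y
        simp only [Finset.mem_filter, Finset.mem_univ, true_and] at this
        exact absurd this ((ord.lt_iff_le_not_ge x y).1 hxy).2
    obtain ⟨M, hM⟩ := exists_add_mem_lexSum ord hJ' hh ha
    obtain ⟨M', hM'⟩ := exists_add_mem_lexSum ord hJ' hh hb
    refine ⟨_, hM _ (le_max_left M M'), _, hM' _ (le_max_right M M'), ?_⟩
    rw [add_sub_add_right_eq_sub]
    exact funext hab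

end Converse

/-! ### Identification of the single blocks. -/

section Blocks

variable {P : Type*} [Fintype P] [DecidableEq P] {n : P → ℕ} {I : Set (BlockMatrix n)} {x : P}

/-- A convex cone of matrices containing the scalars and all rank-one projections contains all
Hermitian matrices. -/
theorem mem_of_forall_lineProj_mem {m : Type*} [Fintype m] [DecidableEq m]
    {J : Set (Matrix m m ℂ)} (hconst : ∀ r : ℝ, r • (1 : Matrix m m ℂ) ∈ J)
    (hadd : ∀ a ∈ J, ∀ b ∈ J, a + b ∈ J) (hsmul : ∀ r : ℝ, 0 ≤ r → ∀ a ∈ J, r • a ∈ J)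
    (hline : ∀ z : m → ℂ, z ≠ 0 → lineProj z ∈ J) {a : Matrix m m ℂ} (ha : a.IsHermitian) :
    a ∈ J := by
  let v : m → m → ℂ := fun i => (ha.eigenvectorBasis i).ofLp
  have hv : ∀ i, v i ≠ 0 := fun i h0 => ha.eigenvectorBasis.orthonormal.ne_zero i (by
    ext j
    exact congrFun h0 j)
  -- Subtracting a lower bound makes all coefficients of the spectral decomposition non-negative.
  obtain ⟨c, hc⟩ := (Set.finite_range ha.eigenvalues).bddBelow
  have hsum : ∑ i, (ha.eigenvalues i - c) • lineProj (v i) ∈ J := by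
    refine Finset.sum_induction _ (· ∈ J) (fun a b ha hb => hadd a ha b hb)
      (by simpa using hconst 0) fun i _ => ?_
    exact hsmul _ (sub_nonneg.2 (hc ⟨i, rfl⟩)) _ (hline _ (hv i))
  have heq : a = ∑ i, (ha.eigenvalues i - c) • lineProj (v i) + c • 1 := by
    refine toEuclideanLin.injective (ha.eigenvectorBasis.toBasis.ext fun j => ?_)
    have h1 : a *ᵥ v j = ha.eigenvalues j • v j := ha.mulVec_eigenvectorBasis j
    have h2 : (∑ i, (ha.eigenvalues i - c) • lineProj (v i) + c • (1 : Matrix m m ℂ)) *ᵥ v j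
        = ha.eigenvalues j • v j := by
      rw [add_mulVec, sum_mulVec, Finset.sum_eq_single j, smul_mulVec, smul_mulVec,
        lineProj_mulVec_self (hv j), one_mulVec, ← add_smul, sub_add_cancel]
      · intro i _ hij
        have : star (v i) ⬝ᵥ v j = 0 := by
          have h : inner ℂ (ha.eigenvectorBasis i) (ha.eigenvectorBasis j) = 0 :=
            ha.eigenvectorBasis.orthonormal.2 hij
          rwa [EuclideanSpace.inner_eq_star_dotProduct, dotProduct_comm] at h
        rw [smul_mulVec, lineProj_mulVec_of_orthogonal this, smul_zero]
      · simp
    have h3 := h1.trans h2.symm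
    simp only [OrthonormalBasis.coe_toBasis, toEuclideanLin, toLpLin_apply]
    exact congrArg (WithLp.toLp 2) h3
  rw [heq]
  exact hadd _ hsum _ (hconst c)

/-- K consists of the rank-one projections in J. Shifting by scalars and rescaling passes between a
non-scalar matrix and its direction, so J is the cone over K, and convexity of J gives the arcs. -/
theorem isListedIsocone_of_eq_two {N : ℕ} (hN : N = 2) {J : Set (Matrix (Fin N) (Fin N) ℂ)}
    (hsa : ∀ a ∈ J, IsSelfAdjoint a) (hconst : ∀ r : ℝ, r • (1 : Matrix (Fin N) (Fin N) ℂ) ∈ J)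
    (hadd : ∀ a ∈ J, ∀ b ∈ J, a + b ∈ J) (hsmul : ∀ r : ℝ, 0 ≤ r → ∀ a ∈ J, r • a ∈ J)
    (hcompact : IsCompact {p ∈ J | IsStarProjection p ∧ p.trace = 1})
    (hint : ∃ b, ∃ δ > 0, ∀ h : Matrix (Fin N) (Fin N) ℂ, IsSelfAdjoint h → ‖h‖ ≤ δ → b + h ∈ J) :
    IsListedIsocone N J := by
  subst hN
  set K : Set (Matrix (Fin 2) (Fin 2) ℂ) := {p ∈ J | IsStarProjection p ∧ p.trace = 1} with hK
  have hKJ : ∀ p ∈ projSphere, p ∈ J → p ∈ K := fun p hp hpJ =>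
    ⟨hpJ, isStarProjection_of_mem hp, hp.2.2⟩
  have hKS : K ⊆ projSphere := fun p hp => ⟨hp.2.1.isSelfAdjoint, hp.2.1.isIdempotentElem, hp.2.2⟩
  have hdir : ∀ (t s : ℝ) (p : Matrix (Fin 2) (Fin 2) ℂ), 0 < t → t • p + s • 1 ∈ J → p ∈ J := by
    intro t s p ht h
    have := hsmul t⁻¹ (by positivity) _ (hadd _ h _ (hconst (-s)))
    rwa [add_assoc, ← add_smul, add_neg_cancel, zero_smul, add_zero, smul_smul,
      inv_mul_cancel₀ ht.ne', one_smul] at this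
  have hKg : IsGeodesicallyConvex K := by
    rintro p hp q hq - z hz ⟨α, β, hα, hβ, h⟩
    refine hKJ z hz ?_
    have : z = α • p + β • q + (1 / 2 - α * (1 / 2) - β * (1 / 2)) • 1 := by
      rw [sub_eq_iff_eq_add] at h
      rw [h]
      module
    rw [this]
    exact hadd _ (hadd _ (hsmul α hα _ hp.1) _ (hsmul β hβ _ hq.1)) _ (hconst _)
  have hKi : (interior {p : projSphere | (p : Matrix (Fin 2) (Fin 2) ℂ) ∈ K}).Nonempty := by
    obtain ⟨b, δ, hδ, hb⟩ := hint
    have hbsa := hsa b (by simpa using hb 0 (.zero _) (by simpa using hδ.le))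
    obtain ⟨p, hp, t, ht, s, hbp⟩ : ∃ p ∈ projSphere, ∃ t : ℝ, 0 ≤ t ∧ ∃ s : ℝ,
        b = t • p + s • 1 := by
      by_cases hr : blochRadius b = 0
      · refine ⟨!![1, 0; 0, 0], ⟨?_, ?_, ?_⟩, 0, le_rfl, blochMid b, ?_⟩
        · ext i j
          fin_cases i <;> fin_cases j <;> simp
        · ext i j
          fin_cases i <;> fin_cases j <;> simp
        · simp [Matrix.trace]
        · rw [zero_smul, zero_add]
          exact eq_of_blochRadius_eq_zero hbsa hr
      · exact ⟨_, blochDir_mem hbsa hr, _, by have := blochRadius_nonneg b; positivity, _,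
          eq_smul_blochDir_add hr⟩
    -- `t` may be 0; the extra `ε` gives `q` the positive coefficient `t + ε`, so that `q` can be
    -- recovered by rescaling.
    obtain ⟨ε, hε, hεδ⟩ : ∃ ε : ℝ, 0 < ε ∧ ‖ε • p‖ < δ := by
      refine ⟨δ / (‖p‖ + 1), by positivity, ?_⟩
      rw [norm_smul, Real.norm_of_nonneg (by positivity), div_mul_eq_mul_div,
        div_lt_iff₀ (by positivity)]
      nlinarith [norm_nonneg p]
    refine ⟨⟨p, hp⟩, mem_interior_iff_mem_nhds.2 ?_⟩
    have hcont : Continuous fun q : projSphere =>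
        ‖(t + ε) • (q : Matrix (Fin 2) (Fin 2) ℂ) - t • p‖ := by fun_prop
    have hev : ∀ᶠ q : projSphere in nhds ⟨p, hp⟩,
        ‖(t + ε) • (q : Matrix (Fin 2) (Fin 2) ℂ) - t • p‖ < δ := by
      refine hcont.continuousAt.eventually_lt continuousAt_const ?_
      rwa [add_smul, add_sub_cancel_left]
    filter_upwards [hev] with q hq
    refine hKJ q q.2 (hdir (t + ε) s q (by positivity) ?_)
    have := hb ((t + ε) • (q : Matrix (Fin 2) (Fin 2) ℂ) - t • p)
      (((IsSelfAdjoint.all _).smul q.2.1).sub ((IsSelfAdjoint.all _).smul hp.1)) hq.le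
    rw [hbp] at this
    convert this using 1
    abel
  have hJ : J = coneOver K := by
    ext a
    constructor
    · intro haJ
      have ha := hsa a haJ
      by_cases hr : blochRadius a = 0
      · obtain ⟨p, hp⟩ := hKi
        exact ⟨0, le_rfl, p, (interior_subset hp : p ∈ {p : projSphere | _}), blochMid a, by
          rw [zero_smul, zero_add]
          exact eq_of_blochRadius_eq_zero ha hr⟩
      · have hpos : 0 < 2 * blochRadius a := by
          have := lt_of_le_of_ne (blochRadius_nonneg a) (Ne.symm hr)
          positivity
        refine ⟨_, hpos.le, _, hKJ _ (blochDir_mem ha hr) (hdir _ (blochMid a - blochRadius a) _ hpos ?_), _,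
          eq_smul_blochDir_add hr⟩
        rwa [← eq_smul_blochDir_add hr]
    · rintro ⟨t, ht, p, hp, s, rfl⟩
      exact hadd _ (hsmul t ht p hp.1) _ (hconst s)
  rw [hJ]
  exact .two K hKS hcompact hKg hKi

namespace IsIsocone

omit [DecidableEq P] in
theorem isCompact_projections (hI : IsIsocone I) : IsCompact (projections I) := by
  have : ProperSpace (BlockMatrix n) := FiniteDimensional.proper ℝ _
  refine Metric.isCompact_of_isClosed_isBounded ?_ ?_
  · have : projections I = I ∩ {p | p * p = p} ∩ {p | star p = p} := by
      ext p
      refine ⟨fun h => ⟨⟨h.1, funext fun x => (h.2 x).isIdempotentElem⟩,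
        funext fun x => (h.2 x).isSelfAdjoint⟩, fun h => ⟨h.1.1, fun x =>
        ⟨congrFun h.1.2 x, congrFun h.2 x⟩⟩⟩
    rw [this]
    exact (hI.closed.inter (isClosed_eq (continuous_id.mul continuous_id) continuous_id)).inter
      (isClosed_eq continuous_star continuous_id)
  · refine (Metric.isBounded_closedBall (x := (0 : BlockMatrix n)) (r := 1)).subset fun p hp => ?_
    rw [mem_closedBall_zero_iff, pi_norm_le_iff_of_nonneg zero_le_one]
    exact fun x => (hp.2 x).norm_le

/-- Closedness of the image is not immediate; in dimension 2, compactness of K comes instead from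
the compact set of projections of I, through lifting by the cut at 1/2. In the other dimensions all
rank-one projections are available; in dimension 1 the only one is the unit. -/
theorem isListedIsocone_image (hI : IsIsocone I) (hn : 0 < n x) :
    IsListedIsocone (n x) ((fun a : BlockMatrix n => a x) '' I) := by
  set J := (fun a : BlockMatrix n => a x) '' I with hJ
  have hsa : ∀ a ∈ J, IsSelfAdjoint a := by
    rintro _ ⟨a, ha, rfl⟩
    exact hI.isSelfAdjoint_apply ha x
  have hconst : ∀ r : ℝ, r • (1 : Matrix (Fin (n x)) (Fin (n x)) ℂ) ∈ J := fun r =>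
    ⟨_, hI.const_mem r, rfl⟩
  have hadd : ∀ a ∈ J, ∀ b ∈ J, a + b ∈ J := by
    rintro _ ⟨a, ha, rfl⟩ _ ⟨b, hb, rfl⟩
    exact ⟨_, hI.add_mem a ha b hb, rfl⟩
  have hsmul : ∀ r : ℝ, 0 ≤ r → ∀ a ∈ J, r • a ∈ J := by
    rintro r hr _ ⟨a, ha, rfl⟩
    exact ⟨_, hI.smul_mem hr ha, rfl⟩
  by_cases h2 : n x = 2
  · refine isListedIsocone_of_eq_two h2 hsa hconst hadd hsmul ?_ ?_
    · have : {p ∈ J | IsStarProjection p ∧ p.trace = 1}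
          = (fun a : BlockMatrix n => a x) '' (projections I ∩ {a | (a x).trace = 1}) := by
        ext p
        constructor
        · rintro ⟨⟨a, ha, rfl⟩, hp, htr⟩
          have h := upperProj_of_isStarProjection hp
          exact ⟨_, ⟨hI.upperProj_mem_projections ha (1 / 2), (congrArg _ h).trans htr⟩, h⟩
        · rintro ⟨a, ⟨ha, htr⟩, rfl⟩
          exact ⟨⟨a, ha.1, rfl⟩, ha.2 x, htr⟩
      rw [this]
      have hcl : IsClosed {a : BlockMatrix n | (a x).trace = 1} := by
        have h1 : Continuous fun a : Matrix (Fin (n x)) (Fin (n x)) ℂ => a.trace := by fun_prop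
        exact isClosed_eq (h1.comp (continuous_apply x)) continuous_const
      exact (hI.isCompact_projections.inter_right hcl).image (continuous_apply x)
    · obtain ⟨b, δ, hδ, hb⟩ := hI.exists_isInteriorPoint
      refine ⟨b x, δ, hδ, fun h hh hn => ⟨_, hb.add_single_mem hh hn, ?_⟩⟩
      simp
  · have hline : ∀ z : Fin (n x) → ℂ, z ≠ 0 → lineProj z ∈ J := by
      intro z hz
      rcases Nat.lt_or_ge (n x) 3 with h3 | h3
      · have h1 : n x = 1 := by omega
        have : Subsingleton (Fin (n x)) := by rw [h1]; infer_instance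
        have h : 1 = lineProj z := eq_lineProj_of_mulVec hz (one_mulVec z) fun u hu => by
          rw [one_mulVec]
          have hi : ∀ i, star (z i) * u i = 0 := fun i => by
            rw [← hu, dotProduct, Fintype.sum_subsingleton _ i, Pi.star_apply]
          funext i
          refine (mul_eq_zero.1 (hi i)).resolve_left fun h0 => hz (funext fun j => ?_)
          rw [Subsingleton.elim j i]
          simpa using h0
        rw [← h]
        simpa using hconst 1
      · obtain ⟨r, hr, h⟩ := hI.exists_lineProj h3 hz
        exact ⟨r, hr.1, h⟩
    have : J = {a | a.IsHermitian} := Set.Subset.antisymm hsa fun a ha =>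
      mem_of_forall_lineProj_mem hconst hadd hsmul hline ha
    rw [this]
    exact .full _ h2

end IsIsocone

end Blocks

theorem mainTheorem1 (k : ℕ) (hk : 0 < k) (n : Fin k → ℕ) (hn : ∀ x, 0 < n x) :
    (∀ I : Set (∀ x : Fin k, Matrix (Fin (n x)) (Fin (n x)) ℂ), IsIsocone I →
      ∃ ord : PartialOrder (Fin k),
        I = lexSum ord (fun x => (fun a => a x) '' I) ∧
        ∀ x, IsIsocone ((fun a => a x) '' I) ∧ IsListedIsocone (n x) ((fun a => a x) '' I)) ∧
    (∀ (ord : PartialOrder (Fin k)) (J : ∀ x : Fin k, Set (Matrix (Fin (n x)) (Fin (n x)) ℂ)),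
      (∀ x, IsListedIsocone (n x) (J x)) → IsIsocone (lexSum ord J)) := by
  refine ⟨fun I hI => ⟨hI.blockOrder hn, hI.eq_lexSum hn, fun x => ?_⟩,
    fun ord J hJ => isIsocone_lexSum ord hJ⟩
  have h := hI.isListedIsocone_image (hn x)
  exact ⟨h.isIsocone, h⟩
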